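/- **Conventions.** A prop $P$ consists of sets $P[a,b]$ of morphisms $a\to b$ ($a,b\in\mathbb N$), an associative composition $\circ : P[b,c]\times P[a,b]\to P[a,c]$, an associative tensor product $\otimes : P[a,b]\times P[c,d]\to P[a+c,b+d]$ with $(f\circ g)\otimes(h\circ k)=(f\otimes h)\circ(g\otimes k)$, an empty morphism $1:0\to 0$ neutral for $\otimes$, an identity $\mathrm{id}:1\to 1$ such that the $\mathrm{id}^{\otimes n}$ (with $\mathrm{id}^{\otimes 0}=1$) are neutral for $\circ$, and a symmetry $\sigma:2\to2$ with $\sigma\circ\sigma=\mathrm{id}^{\otimes 2}$ and $\sigma_b\circ(f\otimes \mathrm{id})=(\mathrm{id}\otimes f)\circ\sigma_a$ for all $f:a\to b$, where $\sigma_0=\mathrm{id}$ and $\sigma_{n+1}=(\sigma_n\otimes\mathrm{id})\circ(\mathrm{id}^{\otimes n}\otimes\sigma)$ ($\sigma_n: n+1\to 1+n$ moves the last wire to the front). Let $\sigma_{a,b}:a+b\to b+a$ be the symmetry exchanging the first $a$ and the last $b$ wires, and $\beta_{a,b,c}:a+b+c\to c+b+a$ the permutation, built from symmetries, that exchanges the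 first block of $a$ wires with the last block of $c$ wires and keeps the middle block in the middle (the order inside each block is unchanged). A prop functor is a family of maps $P[a,b]\to Q[a,b]$ preserving $\circ,\otimes,1,\mathrm{id},\sigma$. A traced prop is a prop with an operator $\mathrm{tr}: P[1+m,1+n]\to P[m,n]$ (with $\mathrm{tr}_p$ its $p$-th iterate) satisfying: tightening $\mathrm{tr}((\mathrm{id}\otimes g)\circ f\circ(\mathrm{id}\otimes h))=g\circ\mathrm{tr}(f)\circ h$; yanking $\mathrm{tr}(\sigma)=\mathrm{id}$; sliding $\mathrm{tr}_n(f\circ(g\otimes\mathrm{id}^{\otimes p}))=\mathrm{tr}_m((g\otimes\mathrm{id}^{\otimes q})\circ f)$ for $f:m+p\to n+q$, $g:n\to m$; strength $\mathrm{tr}(f\otimes g)=\mathrm{tr}(f)\otimes g$. A traced prop functor is a prop functor preserving $\mathrm{tr}$. A traced completion of a prop $P$ is a traced prop $\widehat P$ with a prop functor $\iota:P\to\widehat P$ such that for every traced prop $S$ and prop functor $\eta:P\to S$ there is a unique traced prop functor $G:\widehat P\to S$ with $G\iota=\eta$. **Proposition.** Let $P$ be a prop. There is a traced prop $Q$, described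 as follows. * Morphisms $n\to m$ of $Q$ are the equivalence classes $[M,k]$ of pairs $(M,k)$ with $k\in\mathbb N$ and $M\in P[k+n,k+m]$, for the smallest equivalence relation $\sim$ such that * (sliding) $((g\otimes\mathrm{id}^{\otimes m})\circ M,\,q)\sim(M\circ(g\otimes\mathrm{id}^{\otimes n}),\,p)$ for all $M:q+n\to p+m$ and $g:p\to q$; * (adding a wire) $(M,k)\sim((\beta_{1,j,1}\otimes\mathrm{id}^{\otimes r})\circ(\mathrm{id}\otimes M),\,k+1)$ for all $M:k+n\to k+m$ and all $j,r\ge 0$ with $k+m=j+1+r$. * The empty morphism, identity and symmetry of $Q$ are $[1,0]$, $[\mathrm{id},0]$, $[\sigma,0]$. * For $M:p+m\to p+n$ and $N:q+r\to q+m$, $[M,p]\circ[N,q]=[(N\otimes M)\circ(\mathrm{id}^{\otimes q}\otimes\beta_{m,p,r}),\;q+m+p]$. * For $M:p+m\to p+n$ and $N:q+m'\to q+n'$, $[M,p]\otimes[N,q]=[(\mathrm{id}^{\otimes p}\otimes\sigma_{n,q}\otimes\mathrm{id}^{\otimes n'})\circ(M\otimes N)\circ(\mathrm{id}^{\otimes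 p}\otimes\sigma_{q,m}\otimes\mathrm{id}^{\otimes m'}),\;p+q]$. * For $M:k+1+m\to k+1+n$, $\mathrm{tr}[M,k]=[M,k+1]$. In particular these operations are well defined on classes and satisfy all axioms of a traced prop. Moreover $\iota_Q: M\mapsto[M,0]$ is a prop functor $P\to Q$, the pair $(Q,\iota_Q)$ is a traced completion of $P$, and for every traced completion $(\widehat P,\iota)$ of $P$ there is an isomorphism of traced props $e:\widehat P\to Q$ with $e\,\iota=\iota_Q$. -/

import Mathlib

universe u v w

/-- Transport of a morphism along equalities of its source and its target. -/
def castHom {Hom : ℕ → ℕ → Type u} {a b a' b' : ℕ} (ha : a = a') (hb : b = b')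
    (f : Hom a b) : Hom a' b' :=
  cast (congrArg₂ Hom ha hb) f

/-- The operations of a prop with morphism sets `Hom a b`, `a b : ℕ`. Composition is written in
the usual order: `comp f g` is `f ∘ g` (first `g`, then `f`). -/
structure PropOps (Hom : ℕ → ℕ → Type u) where
  comp : {a b c : ℕ} → Hom b c → Hom a b → Hom a c
  tensor : {a b c d : ℕ} → Hom a b → Hom c d → Hom (a + c) (b + d)
  /-- the empty morphism -/
  empty : Hom 0 0
  /-- the identity wire -/
  wire : Hom 1 1
  /-- the symmetry -/
  sigma : Hom 2 2

namespace PropOps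

variable {Hom : ℕ → ℕ → Type u} (P : PropOps Hom)

/-- `id^{⊗ n}`, with `id^{⊗ 0}` the empty morphism. -/
def idn : (n : ℕ) → Hom n n
  | 0 => P.empty
  | n + 1 => P.tensor (idn n) P.wire

/-- `σ_n : n + 1 → 1 + n` moves the last wire in front of the first `n` wires. -/
def sym : (n : ℕ) → Hom (n + 1) (1 + n)
  | 0 => P.wire
  | n + 1 => P.comp (b := n + 1 + 1) (P.tensor (a := n + 1) (b := 1 + n) (sym n) P.wire)
      (P.tensor (a := n) (b := n) (P.idn n) P.sigma)

/-- `σ_{a,b} : a + b → b + a` exchanges the first `a` wires and the last `b` wires. -/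
def symm (a : ℕ) : (b : ℕ) → Hom (a + b) (b + a)
  | 0 => castHom rfl (Nat.zero_add a).symm (P.idn a)
  | b + 1 => castHom rfl (Nat.add_assoc b 1 a).symm
      (P.comp (b := b + (a + 1)) (P.tensor (a := b) (b := b) (P.idn b) (P.sym a))
        (P.tensor (a := a + b) (b := b + a) (symm a b) P.wire))

/-- The permutation `a + b + c → c + b + a` which exchanges the first block of `a` wires and the
last block of `c` wires, and keeps the middle block of `b` wires in the middle; the order of the
wires inside each block is unchanged. -/
def blockSwap (a b c : ℕ) : Hom (a + b + c) (c + b + a) :=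
  P.comp (P.tensor (P.symm b c) (P.idn a))
    (P.comp
      (castHom (Nat.add_assoc b a c).symm (Nat.add_assoc b c a).symm
        (P.tensor (P.idn b) (P.symm a c)))
      (P.tensor (P.symm a b) (P.idn c)))

end PropOps

/-- A prop with morphism sets `Hom a b`: the operations together with their laws. -/
structure PropStr (Hom : ℕ → ℕ → Type u) extends PropOps Hom where
  comp_assoc : ∀ {a b c d : ℕ} (f : Hom c d) (g : Hom b c) (h : Hom a b),
    comp (comp f g) h = comp f (comp g h)
  tensor_assoc : ∀ {a b c d e i : ℕ} (f : Hom a b) (g : Hom c d) (h : Hom e i),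
    castHom (Nat.add_assoc a c e) (Nat.add_assoc b d i) (tensor (tensor f g) h) =
      tensor f (tensor g h)
  interchange : ∀ {a b c d e i : ℕ} (f : Hom b c) (g : Hom a b) (h : Hom e i) (k : Hom d e),
    tensor (comp f g) (comp h k) = comp (tensor f h) (tensor g k)
  tensor_empty : ∀ {a b : ℕ} (f : Hom a b), tensor f empty = f
  empty_tensor : ∀ {a b : ℕ} (f : Hom a b),
    castHom (Nat.zero_add a) (Nat.zero_add b) (tensor empty f) = f
  comp_idn : ∀ {a b : ℕ} (f : Hom a b), comp f (toPropOps.idn a) = f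
  idn_comp : ∀ {a b : ℕ} (f : Hom a b), comp (toPropOps.idn b) f = f
  sigma_sigma : comp sigma sigma = toPropOps.idn 2
  sym_natural : ∀ {a b : ℕ} (f : Hom a b),
    comp (toPropOps.sym b) (tensor f wire) = comp (tensor wire f) (toPropOps.sym a)

/-- `tr_p`: the `p`-th iterate of an operator `tr` that removes the first wire. -/
def iterTrace {Hom : ℕ → ℕ → Type u}
    (tr : {m n : ℕ} → Hom (1 + m) (1 + n) → Hom m n) :
    (p : ℕ) → {m n : ℕ} → Hom (p + m) (p + n) → Hom m n
  | 0, m, n, f => castHom (Nat.zero_add m) (Nat.zero_add n) f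
  | p + 1, m, n, f =>
      iterTrace tr p (tr (castHom (by omega : p + 1 + m = 1 + (p + m))
        (by omega : p + 1 + n = 1 + (p + n)) f))

/-- A traced prop: a prop with a trace operator, which plugs the first output into the first
input, subject to tightening, yanking, sliding and strength. -/
structure TracedPropStr (Hom : ℕ → ℕ → Type u) extends PropStr Hom where
  trace : {m n : ℕ} → Hom (1 + m) (1 + n) → Hom m n
  tightening : ∀ {a b c d : ℕ} (g : Hom c d) (f : Hom (1 + b) (1 + c)) (h : Hom a b),
    trace (comp (comp (tensor wire g) f) (tensor wire h)) = comp (comp g (trace f)) h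
  yanking : trace (m := 1) (n := 1) sigma = wire
  sliding : ∀ {m n p q : ℕ} (f : Hom (m + p) (n + q)) (g : Hom n m),
    iterTrace trace n (comp f (tensor g (toPropOps.idn p))) =
      iterTrace trace m (comp (tensor g (toPropOps.idn q)) f)
  strength : ∀ {a b c d : ℕ} (f : Hom (1 + a) (1 + b)) (g : Hom c d),
    trace (castHom (Nat.add_assoc 1 a c) (Nat.add_assoc 1 b d) (tensor f g)) =
      tensor (trace f) g

/-- A prop functor (morphism of props). -/
structure PropFunctor {A : ℕ → ℕ → Type u} {B : ℕ → ℕ → Type v}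
    (P : PropStr A) (Q : PropStr B) where
  map : {a b : ℕ} → A a b → B a b
  map_comp : ∀ {a b c : ℕ} (f : A b c) (g : A a b), map (P.comp f g) = Q.comp (map f) (map g)
  map_tensor : ∀ {a b c d : ℕ} (f : A a b) (g : A c d),
    map (P.tensor f g) = Q.tensor (map f) (map g)
  map_wire : map P.wire = Q.wire
  map_empty : map P.empty = Q.empty
  map_sigma : map P.sigma = Q.sigma

/-- A traced prop functor: a prop functor that preserves the trace. -/
structure TracedPropFunctor {A : ℕ → ℕ → Type u} {B : ℕ → ℕ → Type v}
    (P : TracedPropStr A) (Q : TracedPropStr B) extends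
    PropFunctor P.toPropStr Q.toPropStr where
  map_trace : ∀ {m n : ℕ} (f : A (1 + m) (1 + n)), map (P.trace f) = Q.trace (map f)

/-- An isomorphism of traced props. -/
structure TracedPropIso {A : ℕ → ℕ → Type u} {B : ℕ → ℕ → Type v}
    (P : TracedPropStr A) (Q : TracedPropStr B) where
  hom : TracedPropFunctor P Q
  inv : TracedPropFunctor Q P
  inv_hom : ∀ {a b : ℕ} (f : A a b), inv.map (hom.map f) = f
  hom_inv : ∀ {a b : ℕ} (f : B a b), hom.map (inv.map f) = f

/-- `(T, ι)` is a traced completion of the prop `P`: for every traced prop `S` and every prop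
functor `η : P → S` there is a unique traced prop functor `G : T → S` with `G ι = η`. -/
def IsTracedCompletion {A : ℕ → ℕ → Type u} {B : ℕ → ℕ → Type v}
    (P : PropStr A) (T : TracedPropStr B) (ι : PropFunctor P T.toPropStr) : Prop :=
  ∀ (C : ℕ → ℕ → Type w) (S : TracedPropStr C) (η : PropFunctor P S.toPropStr),
    ∃! G : TracedPropFunctor T S, ∀ (a b : ℕ) (f : A a b), G.map (ι.map f) = η.map f

section Construction

variable {A : ℕ → ℕ → Type u} (P : PropStr A)

/-- The pairs `(M, k)` with `M ∈ P[k + n, k + m]` (here with `k` as first component). -/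
abbrev TracePair (_P : PropStr A) (n m : ℕ) : Type u := (k : ℕ) × A (k + n) (k + m)

/-- For `M : k + n → k + m` with `k + m = j + 1 + r`: put a new wire on top of `M`, and exchange
the output of that wire with the `(j + 1)`-st output of `M`, all other outputs keeping their
position. -/
def addWire {k n m : ℕ} (j r : ℕ) (h : k + m = j + 1 + r) (M : A (k + n) (k + m)) :
    A (k + 1 + n) (k + 1 + m) :=
  castHom (by omega) (by omega)
    (P.comp (P.tensor (P.blockSwap 1 j 1) (P.idn r))
      (castHom rfl (by omega : 1 + (k + m) = 1 + j + 1 + r) (P.tensor P.wire M)))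

/-- The two rules that generate the equivalence relation on pairs. -/
inductive TraceRel (n m : ℕ) : TracePair P n m → TracePair P n m → Prop
  | slide (p q : ℕ) (M : A (q + n) (p + m)) (g : A p q) :
      TraceRel n m ⟨q, P.comp (P.tensor g (P.idn m)) M⟩ ⟨p, P.comp M (P.tensor g (P.idn n))⟩
  | addWire (k j r : ℕ) (h : k + m = j + 1 + r) (M : A (k + n) (k + m)) :
      TraceRel n m ⟨k, M⟩ ⟨k + 1, addWire P j r h M⟩

/-- The morphisms `n → m` of the explicit prop: classes of pairs modulo the equivalence relation
generated by `TraceRel` (`Quot` is the quotient by the generated equivalence relation). -/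
def TraceHom (n m : ℕ) : Type u := Quot (TraceRel P n m)

/-- The class `[M, k]`. -/
def traceClass {n m : ℕ} (k : ℕ) (M : A (k + n) (k + m)) : TraceHom P n m :=
  Quot.mk _ ⟨k, M⟩

/-- `M ↦ [M, 0]`. -/
def ofProp {n m : ℕ} (M : A n m) : TraceHom P n m :=
  traceClass P 0 (castHom (Nat.zero_add n).symm (Nat.zero_add m).symm M)

/-- For `M : p + m → p + n` and `N : q + r → q + m`, the morphism
`(N ⊗ M) ∘ (id^{⊗ q} ⊗ β)` from `(q + m + p) + r` to `(q + m + p) + n`, where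
`β : m + p + r → r + p + m` is the block swap. -/
def compRep {p q r m n : ℕ} (M : A (p + m) (p + n)) (N : A (q + r) (q + m)) :
    A (q + m + p + r) (q + m + p + n) :=
  castHom (by omega) (by omega)
    (P.comp (P.tensor N M)
      (castHom rfl (by omega : q + (r + p + m) = q + r + (p + m))
        (P.tensor (P.idn q) (P.blockSwap m p r))))

/-- For `M : p + m → p + n` and `N : q + m' → q + n'`, the morphism
`(id^{⊗ p} ⊗ σ_{n,q} ⊗ id^{⊗ n'}) ∘ (M ⊗ N) ∘ (id^{⊗ p} ⊗ σ_{q,m} ⊗ id^{⊗ m'})`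
from `(p + q) + (m + m')` to `(p + q) + (n + n')`. -/
def tensorRep {p q m n m' n' : ℕ} (M : A (p + m) (p + n)) (N : A (q + m') (q + n')) :
    A (p + q + (m + m')) (p + q + (n + n')) :=
  castHom (by omega) (by omega)
    (P.comp (P.tensor (P.tensor (P.idn p) (P.symm n q)) (P.idn n'))
      (P.comp
        (castHom (by omega : p + m + (q + m') = p + (m + q) + m')
          (by omega : p + n + (q + n') = p + (n + q) + n') (P.tensor M N))
        (P.tensor (P.tensor (P.idn p) (P.symm q m)) (P.idn m'))))

end Construction

/-! Read `[M, k]` as the diagram `M` whose first `k` outputs are fed back into its first `k` inputs.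
The proof has three layers.

Coherence: a bijection of wires determines a single morphism `P.perm e`, compatibly with `∘` and
`⊗`. Permutations are sent to a normal form (a cycle after a permutation of fewer wires), and
`ofPerm_adjSwap_mul` shows that composing with an adjacent exchange follows multiplication of
permutations; the essential input is the Yang–Baxter relation, a case of naturality of the symmetry.
Every diagram then becomes `conj π F ρ`, with `F` a tensor product of boxes, and rewiring identities
become equalities of bijections, decided pointwise by arithmetic.

The quotient: sliding a permutation makes the order of the feedback wires irrelevant
(`loopClass_eq`), and adding a wire cuts a wire and reroutes it through feedback
(`loopClass_addWire`). Composition also routes its connecting wires through feedback. Associativity,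
interchange and strength therefore only reorder feedback wires, while identity laws, yanking and
tightening also insert wires. The right identity law is the delicate one: new wires are inserted at
outputs of `M` but are needed at its inputs, so `M` itself is slid around the loop.

Universality: `[M, k]` equals `tr_k [M, 0]`, so an extension of `η` must send it to `tr_k (η M)`.
This value respects sliding by the sliding axiom and wire insertion by yanking, strength and
tightening; `iterTrace_compRep` and `iterTrace_tensorRep` make it a functor. Uniqueness then gives
the comparison isomorphism. -/

set_option linter.unusedSimpArgs false

/-! ### Transport along equalities of arities -/

section CastHom

variable {Hom : ℕ → ℕ → Type u}

theorem castHom_self {a b : ℕ} (ha : a = a) (hb : b = b) (f : Hom a b) : castHom ha hb f = f :=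
  rfl

theorem castHom_castHom {a b a' b' a'' b'' : ℕ} (ha : a = a') (hb : b = b') (ha' : a' = a'')
    (hb' : b' = b'') (f : Hom a b) :
    castHom ha' hb' (castHom ha hb f) = castHom (ha.trans ha') (hb.trans hb') f := by
  subst ha hb ha' hb'; rfl

end CastHom

/-! ### Relations between adjacent exchanges and cycles -/

namespace PropStr

variable {Hom : ℕ → ℕ → Type u} (P : PropStr Hom)

theorem idn_one : P.idn 1 = P.wire := P.empty_tensor P.wire

theorem wire_comp_wire : P.comp P.wire P.wire = P.wire := by
  have := P.comp_idn P.wire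
  rwa [idn_one] at this

theorem idn_tensor_idn (a b : ℕ) : P.tensor (P.idn a) (P.idn b) = P.idn (a + b) := by
  induction b with
  | zero => exact P.tensor_empty _
  | succ b ih =>
    have := P.tensor_assoc (P.idn a) (P.idn b) P.wire
    rw [ih] at this
    exact this.symm

/-- `f ⊗ id`. -/
abbrev tensorWire {a b : ℕ} (f : Hom a b) : Hom (a + 1) (b + 1) := P.tensor f P.wire

/-- `id^{⊗ n} ⊗ σ`. -/
abbrev idnSigma (n : ℕ) : Hom (n + 2) (n + 2) := P.tensor (P.idn n) P.sigma

theorem comp_tensor_wire {a b c : ℕ} (f : Hom b c) (g : Hom a b) :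
    P.tensorWire (P.comp f g) = P.comp (P.tensorWire f) (P.tensorWire g) := by
  dsimp only [tensorWire]
  rw [← P.interchange, wire_comp_wire]

theorem idn_tensor_comp {a b c : ℕ} (f : Hom b c) (g : Hom a b) (n : ℕ) :
    P.tensor (P.idn n) (P.comp f g) = P.comp (P.tensor (P.idn n) f) (P.tensor (P.idn n) g) := by
  rw [← P.interchange, P.comp_idn]

theorem tensor_eq_comp {a b c d : ℕ} (f : Hom a b) (g : Hom c d) :
    P.tensor f g = P.comp (P.tensor f (P.idn d)) (P.tensor (P.idn a) g) := by
  rw [← P.interchange, P.comp_idn, P.idn_comp]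

theorem tensor_eq_comp' {a b c d : ℕ} (f : Hom a b) (g : Hom c d) :
    P.tensor f g = P.comp (P.tensor (P.idn b) g) (P.tensor f (P.idn c)) := by
  rw [← P.interchange, P.comp_idn, P.idn_comp]

/-- The symmetry exchanging the wires `i` and `i + 1`, and the identity if `n < i + 2`. -/
def adj (i : ℕ) : (n : ℕ) → Hom n n
  | 0 => P.empty
  | 1 => P.wire
  | n + 2 => if i = n then P.idnSigma n else P.tensorWire (adj i (n + 1))

/-- The permutation moving the last wire to position `j`. -/
def cyc (j : ℕ) : (n : ℕ) → Hom n n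
  | 0 => P.empty
  | 1 => P.wire
  | n + 2 => if n < j then P.idn (n + 2) else
      P.comp (P.tensorWire (cyc j (n + 1))) (P.idnSigma n)

theorem adj_last (n : ℕ) : P.adj n (n + 2) = P.idnSigma n := by simp [adj]

theorem adj_succ {i n : ℕ} (h : i ≠ n) : P.adj i (n + 2) = P.tensorWire (P.adj i (n + 1)) := by
  simp [adj, h]

theorem cyc_last (n : ℕ) : P.cyc n (n + 1) = P.idn (n + 1) := by
  cases n with
  | zero => exact P.idn_one.symm
  | succ n => simp [cyc]

theorem cyc_succ {j n : ℕ} (h : j ≤ n) : P.cyc j (n + 2) =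
    P.comp (P.tensorWire (P.cyc j (n + 1))) (P.idnSigma n) := by
  simp [cyc, Nat.not_lt.2 h]

theorem idn_tensor_sigma_sq (n : ℕ) :
    P.comp (P.idnSigma n) (P.idnSigma n) = P.idn (n + 2) := by
  rw [← idn_tensor_comp, P.sigma_sigma, idn_tensor_idn]

theorem adj_comp_adj (i n : ℕ) : P.comp (P.adj i n) (P.adj i n) = P.idn n := by
  induction n using Nat.strong_induction_on with
  | _ n ih =>
    match n with
    | 0 => exact P.idn_comp (b := 0) P.empty
    | 1 => exact P.wire_comp_wire.trans P.idn_one.symm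
    | n + 2 =>
      by_cases h : i = n
      · subst h; rw [adj_last]; exact P.idn_tensor_sigma_sq i
      · rw [adj_succ P h]
        refine (P.comp_tensor_wire _ _).symm.trans ?_
        rw [ih _ (by omega)]; rfl

/-- Together with `adj_comp_cyc_succ`, `adj_comp_cyc_lt` and `adj_comp_cyc_gt`, this treats every
position of an adjacent exchange relative to the target of the cycle. These are all the relations
that the normal form requires. -/
theorem adj_comp_cyc_self {i n : ℕ} (h : i + 2 ≤ n) :
    P.comp (P.adj i n) (P.cyc i n) = P.cyc (i + 1) n := by
  induction n with
  | zero => omega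
  | succ n ih =>
    obtain ⟨n, rfl⟩ : ∃ k, n = k + 1 := ⟨n - 1, by omega⟩
    rcases Nat.lt_or_ge i n with hi | hi
    · rw [adj_succ P hi.ne, cyc_succ P hi.le, cyc_succ P (show i + 1 ≤ n by omega),
        ← ih (by omega), comp_tensor_wire]
      exact (P.comp_assoc _ _ _).symm
    · obtain rfl : i = n := by omega
      rw [adj_last, cyc_succ P le_rfl, cyc_last, cyc_last]
      refine Eq.trans ?_ (P.idn_tensor_sigma_sq i)
      congr 1
      exact P.idn_comp (P.idnSigma i)

theorem adj_comp_cyc_succ {i n : ℕ} (h : i + 2 ≤ n) :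
    P.comp (P.adj i n) (P.cyc (i + 1) n) = P.cyc i n := by
  rw [← adj_comp_cyc_self P h, ← P.comp_assoc, adj_comp_adj, P.idn_comp]

theorem adj_tensor_comm {a : ℕ} (f : Hom a a) :
    P.comp (P.tensorWire (P.tensorWire f)) (P.idnSigma a) =
      P.comp (P.idnSigma a) (P.tensorWire (P.tensorWire f)) := by
  have h : P.tensorWire (P.tensorWire f) = P.tensor f (P.idn 2) := by
    refine (P.tensor_assoc f P.wire P.wire).trans ?_
    rw [← idn_one, idn_tensor_idn]
  have h1 := P.tensor_eq_comp f P.sigma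
  have h2 := P.tensor_eq_comp' f P.sigma
  rw [h1, ← h] at h2
  exact h2

/-- This is naturality of `sym` at the morphism `σ`, once `sym 2` is written out as two symmetries.
-/
theorem yang_baxter :
    P.comp (c := 3) (P.tensor P.wire P.sigma)
      (P.comp (b := 3) (P.tensor P.sigma P.wire) (P.tensor P.wire P.sigma)) =
    P.comp (c := 3) (P.tensor P.sigma P.wire)
      (P.comp (b := 3) (P.tensor P.wire P.sigma) (P.tensor P.sigma P.wire)) := by
  have h := P.sym_natural P.sigma
  have h1 : P.sym 1 = P.sigma := by
    have : P.sym 1 = P.comp (P.tensorWire P.wire) (P.idnSigma 0) := rfl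
    rw [this, tensorWire, ← idn_one, idn_tensor_idn]
    exact (P.idn_comp _).trans (P.empty_tensor P.sigma)
  have h2 : P.sym 2 = P.comp (b := 3) (P.tensor P.sigma P.wire) (P.tensor P.wire P.sigma) := by
    have : P.sym 2 = P.comp (P.tensorWire (P.sym 1)) (P.idnSigma 1) := rfl
    rw [this, idnSigma, tensorWire, idn_one, h1]
  rw [h2] at h
  rw [← h]
  exact (P.comp_assoc _ _ _)

/-- If the exchange avoids the last wire, it commutes with the final symmetry of the cycle and
induction applies; if it involves the last wire, Yang–Baxter does the work. -/
theorem adj_comp_cyc_lt {i j n : ℕ} (hj : j ≤ i) (h : i + 2 ≤ n) :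
    P.comp (P.adj (i + 1) (n + 1)) (P.cyc j (n + 1)) =
      P.comp (P.cyc j (n + 1)) (P.tensorWire (P.adj i n)) := by
  induction n with
  | zero => omega
  | succ n ih =>
    obtain ⟨n, rfl⟩ : ∃ k, n = k + 1 := ⟨n - 1, by omega⟩
    rcases Nat.lt_or_ge i n with hi | hi
    · have ih := congrArg (fun t => P.comp (P.tensorWire t)
        (P.idnSigma (n + 1))) (ih (by omega))
      simp only [comp_tensor_wire] at ih
      rw [adj_succ P (show i + 1 ≠ n + 1 by omega), cyc_succ P (show j ≤ n + 1 by omega)]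
      refine (P.comp_assoc _ _ _).symm.trans (ih.trans ?_)
      rw [adj_succ P hi.ne]
      refine (P.comp_assoc _ _ _).trans (Eq.trans ?_ (P.comp_assoc _ _ _).symm)
      congr 1
      exact P.adj_tensor_comm _
    · obtain rfl : i = n := by omega
      rw [adj_last, adj_last, cyc_succ P (show j ≤ i + 1 by omega), cyc_succ P hj,
        comp_tensor_wire]
      have e1 : P.idnSigma (i + 1) = P.tensor (P.idn i) (P.tensor P.wire P.sigma) :=
        P.tensor_assoc (P.idn i) P.wire P.sigma
      have e2 : P.tensorWire (P.idnSigma i) =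
        P.tensor (P.idn i) (P.tensor P.sigma P.wire) := P.tensor_assoc (P.idn i) P.sigma P.wire
      have yb := congrArg (P.tensor (P.idn i)) P.yang_baxter
      simp only [idn_tensor_comp] at yb
      rw [e1, e2]
      have c := P.adj_tensor_comm (P.cyc j (i + 1))
      rw [e1] at c
      generalize P.tensor (P.idn i) (P.tensor P.wire P.sigma) = x at *
      generalize P.tensor (P.idn i) (P.tensor P.sigma P.wire) = y at *
      change Hom (i + 3) (i + 3) at x
      change Hom (i + 3) (i + 3) at y
      generalize P.tensorWire (P.tensorWire (P.cyc j (i + 1))) = z at *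
      change Hom (i + 3) (i + 3) at z
      -- Since `xz = zx` and `xyx = yxy`, both sides equal `zyxy`.
      change P.comp x (P.comp (P.comp z y) x) = P.comp (P.comp (P.comp z y) x) y
      change P.comp z x = P.comp x z at c
      change P.comp x (P.comp y x) = P.comp y (P.comp x y) at yb
      rw [P.comp_assoc z, ← P.comp_assoc x, ← c, P.comp_assoc z, yb, P.comp_assoc, P.comp_assoc]

theorem adj_comp_cyc_gt {i j n : ℕ} (hi : i + 1 < j) (h : j ≤ n) :
    P.comp (P.adj i (n + 1)) (P.cyc j (n + 1)) =
      P.comp (P.cyc j (n + 1)) (P.tensorWire (P.adj i n)) := by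
  induction n with
  | zero => omega
  | succ n ih =>
    rcases Nat.lt_or_ge n j with hj | hj
    · obtain rfl : j = n + 1 := by omega
      rw [cyc_last, P.comp_idn, adj_succ P (by omega)]
      exact (P.idn_comp _).symm
    · obtain ⟨n, rfl⟩ : ∃ k, n = k + 1 := ⟨n - 1, by omega⟩
      have ih := congrArg (fun t => P.comp (P.tensorWire t)
        (P.idnSigma (n + 1))) (ih hj)
      simp only [comp_tensor_wire] at ih
      rw [adj_succ P (show i ≠ n + 1 by omega), cyc_succ P hj]
      refine (P.comp_assoc _ _ _).symm.trans (ih.trans ?_)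
      rw [adj_succ P (show i ≠ n by omega)]
      refine (P.comp_assoc _ _ _).trans (Eq.trans ?_ (P.comp_assoc _ _ _).symm)
      congr 1
      exact P.adj_tensor_comm _

end PropStr

/-! ### Bijections of finite ordinals and deletion of a point -/

section FinEquiv

/-- The equivalence `Fin a ≃ Fin b` given by functions on natural numbers. -/
def natEquiv {a b : ℕ} (f g : ℕ → ℕ) (hf : ∀ i < a, f i < b ∧ g (f i) = i)
    (hg : ∀ i < b, g i < a ∧ f (g i) = i) : Fin a ≃ Fin b where
  toFun i := ⟨f i, (hf i i.2).1⟩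
  invFun i := ⟨g i, (hg i i.2).1⟩
  left_inv i := Fin.ext (hf i i.2).2
  right_inv i := Fin.ext (hg i i.2).2

@[simp] theorem natEquiv_val {a b : ℕ} (f g : ℕ → ℕ) (hf : ∀ i < a, f i < b ∧ g (f i) = i)
    (hg : ∀ i < b, g i < a ∧ f (g i) = i) (i : Fin a) : (natEquiv f g hf hg i : ℕ) = f i := rfl

/-- The juxtaposition of two bijections. -/
def addPerm {a b c d : ℕ} (e : Fin a ≃ Fin b) (f : Fin c ≃ Fin d) : Fin (a + c) ≃ Fin (b + d) :=
  finSumFinEquiv.symm.trans ((Equiv.sumCongr e f).trans finSumFinEquiv)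

@[simp] theorem addPerm_val {a b c d : ℕ} (e : Fin a ≃ Fin b) (f : Fin c ≃ Fin d)
    (i : Fin (a + c)) : (addPerm e f i : ℕ) =
      if h : (i : ℕ) < a then (e ⟨i, h⟩ : ℕ) else b + f ⟨i - a, by omega⟩ := by
  refine Fin.addCases (fun i => ?_) (fun i => ?_) i <;> simp [addPerm]

@[simp] theorem finAddFlip_val {a b : ℕ} (i : Fin (a + b)) :
    ((finAddFlip i : Fin (b + a)) : ℕ) = if (i : ℕ) < a then b + i else i - a := by
  refine Fin.addCases (fun i => ?_) (fun i => ?_) i <;> simp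

theorem addPerm_trans {a b c a' b' c' : ℕ} (e : Fin a ≃ Fin b) (f : Fin b ≃ Fin c)
    (e' : Fin a' ≃ Fin b') (f' : Fin b' ≃ Fin c') :
    addPerm (e.trans f) (e'.trans f') = (addPerm e e').trans (addPerm f f') := by
  ext i
  refine Fin.addCases (fun i => ?_) (fun i => ?_) i <;> simp [addPerm]

theorem addPerm_refl (a b : ℕ) : addPerm (Equiv.refl (Fin a)) (Equiv.refl (Fin b)) =
    Equiv.refl (Fin (a + b)) := by
  ext i
  refine Fin.addCases (fun i => ?_) (fun i => ?_) i <;> simp [addPerm]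

theorem addPerm_finCongr {a b : ℕ} (h : a = b) (c : ℕ) :
    addPerm (finCongr h) (Equiv.refl (Fin c)) = finCongr (by rw [h]) := by
  subst h
  exact addPerm_refl a c

/-- The bijection obtained from a permutation by deleting the last point and its image. -/
def removeLast {n : ℕ} (π : Equiv.Perm (Fin (n + 1))) : Equiv.Perm (Fin n) :=
  (finSuccAboveEquiv (Fin.last n)).trans
    ((π.subtypeEquiv (fun a => by simp)).trans (finSuccAboveEquiv (π (Fin.last n))).symm)

theorem succAbove_removeLast {n : ℕ} (π : Equiv.Perm (Fin (n + 1))) (x : Fin n) :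
    (π (Fin.last n)).succAbove (removeLast π x) = π x.castSucc := by
  have h := (finSuccAboveEquiv (π (Fin.last n))).apply_symm_apply
    ((π.subtypeEquiv (fun a => by simp)) (finSuccAboveEquiv (Fin.last n) x))
  rw [← Fin.succAbove_last_apply]
  exact congrArg Subtype.val h

theorem removeLast_eq {n : ℕ} (π : Equiv.Perm (Fin (n + 1))) (ρ : Equiv.Perm (Fin n))
    (h : ∀ x, (π (Fin.last n)).succAbove (ρ x) = π x.castSucc) : removeLast π = ρ := by
  ext1 x
  apply Fin.succAbove_right_injective (p := π (Fin.last n))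
  rw [h, succAbove_removeLast]

/-- For an adjacent exchange `s`, the permutation `t` is the exchange induced on the remaining
points, or `1` if `s` merely moves the image of the last point past a neighbour. -/
theorem removeLast_mul {n : ℕ} (s π : Equiv.Perm (Fin (n + 1))) (t : Equiv.Perm (Fin n))
    (h : ∀ y, (s (π (Fin.last n))).succAbove (t y) = s ((π (Fin.last n)).succAbove y)) :
    removeLast (s * π) = t * removeLast π := by
  apply removeLast_eq
  intro x
  simp [h, succAbove_removeLast]

/-- The transposition exchanging `i` and `i + 1`. -/
abbrev adjSwap (i n : ℕ) (h : i + 2 ≤ n) : Equiv.Perm (Fin n) :=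
  Equiv.swap ⟨i, by omega⟩ ⟨i + 1, by omega⟩

theorem adjSwap_val {i n : ℕ} (h : i + 2 ≤ n) (x : Fin n) :
    (adjSwap i n h x : ℕ) = if (x : ℕ) = i then i + 1 else if (x : ℕ) = i + 1 then i else x := by
  simp only [adjSwap, Equiv.swap_apply_def, Fin.ext_iff]
  split_ifs <;> rfl

theorem succAbove_val {n : ℕ} (p : Fin (n + 1)) (x : Fin n) :
    (p.succAbove x : ℕ) = if (x : ℕ) < p then (x : ℕ) else x + 1 := by
  simp only [Fin.succAbove, Fin.lt_def, Fin.val_castSucc]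
  split_ifs <;> simp

/-- Adjacent transpositions generate the symmetric group as a monoid. Only generation is used: no
presentation by relations is needed, because `ofPerm` is defined on permutations and not on words.
-/
theorem perm_induction {n : ℕ} {motive : Equiv.Perm (Fin n) → Prop} (one : motive 1)
    (adj : ∀ i h π, motive π → motive (adjSwap i n h * π)) (π : Equiv.Perm (Fin n)) :
    motive π := by
  cases n with
  | zero => rwa [Subsingleton.elim π 1]
  | succ n =>
    have hπ : π ∈ Submonoid.closure (Set.range fun i : Fin n => Equiv.swap i.castSucc i.succ) := by
      rw [Equiv.Perm.mclosure_swap_castSucc_succ]; trivial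
    induction hπ using Submonoid.closure_induction_left with
    | one => exact one
    | mul_left x hx y _ ih =>
      obtain ⟨i, rfl⟩ := hx
      exact adj i (by omega) _ ih

end FinEquiv

/-! ### Coherence: the morphism of a bijection of wires -/

namespace PropStr

variable {Hom : ℕ → ℕ → Type u} (P : PropStr Hom)

/-- The morphism given by a permutation. -/
def ofPerm : (n : ℕ) → Equiv.Perm (Fin n) → Hom n n
  | 0, _ => P.empty
  | n + 1, π => P.comp (P.cyc (π (Fin.last n)) (n + 1)) (P.tensorWire (ofPerm n (removeLast π)))

theorem ofPerm_one (n : ℕ) : P.ofPerm n 1 = P.idn n := by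
  induction n with
  | zero => rfl
  | succ n ih =>
    have h : removeLast (1 : Equiv.Perm (Fin (n + 1))) = 1 :=
      removeLast_eq _ _ (fun x => by simp)
    rw [ofPerm, h, ih]
    simp only [Equiv.Perm.coe_one, id_eq, Fin.val_last, cyc_last]
    exact P.idn_comp (P.idn (n + 1))

/-- Let `p` be the image of the last point. If `p` is `i` or `i + 1`, the exchange changes only the
cycle; otherwise it passes through the cycle, with its index lowered by one when `p < i`, and acts
on the smaller permutation. -/
theorem ofPerm_adjSwap_mul {i n : ℕ} (h : i + 2 ≤ n) (π : Equiv.Perm (Fin n)) :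
    P.ofPerm n (adjSwap i n h * π) = P.comp (P.adj i n) (P.ofPerm n π) := by
  induction n generalizing i with
  | zero => omega
  | succ n ih =>
    have hs := adjSwap_val h (π (Fin.last n))
    rw [ofPerm, ofPerm, Equiv.Perm.mul_apply, ← P.comp_assoc]
    have key : ∀ t : Equiv.Perm (Fin n), (∀ y, (adjSwap i _ h (π (Fin.last n))).succAbove (t y) =
        adjSwap i _ h ((π (Fin.last n)).succAbove y)) →
        removeLast (adjSwap i _ h * π) = t * removeLast π := fun t ht => removeLast_mul _ _ _ ht
    have hp := (π (Fin.last n)).2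
    generalize π (Fin.last n) = p at *
    rcases lt_trichotomy (p : ℕ) i with hi | hi | hi
    · obtain ⟨i, rfl⟩ : ∃ k, i = k + 1 := ⟨i - 1, by omega⟩
      rw [key (adjSwap i n (by omega)), ih, adj_comp_cyc_lt P (by omega) (by omega), hs,
        if_neg (by omega), if_neg (by omega), comp_tensor_wire, P.comp_assoc]
      intro y
      ext
      simp only [succAbove_val, adjSwap_val]
      split_ifs <;> omega
    · rw [key 1, one_mul, hs, if_pos hi, hi, adj_comp_cyc_self P h]
      intro y
      ext
      simp only [succAbove_val, adjSwap_val, Equiv.Perm.coe_one, id_eq]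
      split_ifs <;> omega
    · rcases Nat.lt_or_ge (i + 1) p with hi' | hi'
      · rw [key (adjSwap i n (by omega)), ih, adj_comp_cyc_gt P (by omega) (by omega), hs,
          if_neg (by omega), if_neg (by omega), comp_tensor_wire, P.comp_assoc]
        intro y
        ext
        simp only [succAbove_val, adjSwap_val]
        split_ifs <;> omega
      · have hi : (p : ℕ) = i + 1 := by omega
        rw [key 1, one_mul, hs, if_neg (by omega), if_pos hi, hi, adj_comp_cyc_succ P h]
        intro y
        ext
        simp only [succAbove_val, adjSwap_val, Equiv.Perm.coe_one, id_eq]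
        split_ifs <;> omega

theorem ofPerm_mul {n : ℕ} (ρ π : Equiv.Perm (Fin n)) :
    P.ofPerm n (ρ * π) = P.comp (P.ofPerm n ρ) (P.ofPerm n π) := by
  induction ρ using perm_induction with
  | one => rw [one_mul, ofPerm_one, P.idn_comp]
  | adj i h ρ ih => rw [mul_assoc, ofPerm_adjSwap_mul, ofPerm_adjSwap_mul, ih, P.comp_assoc]

theorem ofPerm_adjSwap {i n : ℕ} (h : i + 2 ≤ n) : P.ofPerm n (adjSwap i n h) = P.adj i n := by
  have := P.ofPerm_adjSwap_mul h 1
  rwa [mul_one, ofPerm_one, P.comp_idn] at this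

theorem adj_add (a : ℕ) {i n : ℕ} (h : i + 2 ≤ n) :
    P.adj (a + i) (a + n) = P.tensor (P.idn a) (P.adj i n) := by
  induction n with
  | zero => omega
  | succ n ih =>
    obtain ⟨n, rfl⟩ : ∃ k, n = k + 1 := ⟨n - 1, by omega⟩
    rcases Nat.lt_or_ge i n with hi | hi
    · rw [adj_succ P hi.ne]
      refine (P.adj_succ (show a + i ≠ a + n by omega)).trans ?_
      have e := ih (by omega)
      change P.adj (a + i) (a + n + 1) = _ at e
      rw [e]
      exact P.tensor_assoc (P.idn a) (P.adj i (n + 1)) P.wire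
    · obtain rfl : i = n := by omega
      rw [adj_last]
      refine (P.adj_last (a + i)).trans ?_
      rw [idnSigma, ← idn_tensor_idn]
      exact P.tensor_assoc (P.idn a) (P.idn i) P.sigma

theorem ofPerm_add_wire {n : ℕ} (π : Equiv.Perm (Fin n)) :
    P.ofPerm (n + 1) (addPerm π (Equiv.refl (Fin 1))) = P.tensorWire (P.ofPerm n π) := by
  have h : addPerm π (Equiv.refl (Fin 1)) (Fin.last n) = Fin.last n := by
    ext; simp
  have h' : removeLast (addPerm π (Equiv.refl (Fin 1))) = π := by
    apply removeLast_eq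
    intro x
    rw [h]
    ext
    simp
  rw [ofPerm, h, h', Fin.val_last, cyc_last, P.idn_comp]

theorem ofPerm_add_idn {n : ℕ} (π : Equiv.Perm (Fin n)) (m : ℕ) :
    P.ofPerm (n + m) (addPerm π (Equiv.refl (Fin m))) = P.tensor (P.ofPerm n π) (P.idn m) := by
  induction m with
  | zero =>
    refine Eq.trans ?_ (P.tensor_empty _).symm
    congr 1
    ext x
    exact (addPerm_val π (Equiv.refl (Fin 0)) x).trans (dif_pos x.2)
  | succ m ih =>
    have h : addPerm π (Equiv.refl (Fin (m + 1))) =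
        addPerm (addPerm π (Equiv.refl (Fin m))) (Equiv.refl (Fin 1)) := by
      ext i
      simp only [addPerm_val, Equiv.refl_apply]
      split_ifs <;> first | rfl | omega
    rw [h]
    refine (P.ofPerm_add_wire _).trans ?_
    exact (congrArg P.tensorWire ih).trans (P.tensor_assoc (P.ofPerm n π) (P.idn m) P.wire)

/-- The normal form peels off the last wire, so wires added on the left are invisible to its
recursion. Induction over adjacent exchanges is used instead, where the shift is `adj_add`. -/
theorem ofPerm_idn_add (n : ℕ) {m : ℕ} (π : Equiv.Perm (Fin m)) :
    P.ofPerm (n + m) (addPerm (Equiv.refl (Fin n)) π) = P.tensor (P.idn n) (P.ofPerm m π) := by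
  induction π using perm_induction with
  | one =>
    rw [ofPerm_one, idn_tensor_idn]
    refine Eq.trans ?_ (P.ofPerm_one _)
    congr 1
    exact addPerm_refl n m
  | adj i h ρ ih =>
    rw [ofPerm_adjSwap_mul, idn_tensor_comp, ← ih, ← adj_add P n h,
      ← ofPerm_adjSwap_mul P (show n + i + 2 ≤ n + m by omega)]
    congr 1
    ext x
    simp only [Equiv.Perm.mul_apply, addPerm_val, adjSwap_val, Equiv.refl_apply]
    split_ifs <;> omega

theorem ofPerm_addPerm {n m : ℕ} (π : Equiv.Perm (Fin n)) (ρ : Equiv.Perm (Fin m)) :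
    P.ofPerm (n + m) (addPerm π ρ) = P.tensor (P.ofPerm n π) (P.ofPerm m ρ) := by
  rw [tensor_eq_comp, ← ofPerm_add_idn, ← ofPerm_idn_add, ← ofPerm_mul]
  congr 1
  exact addPerm_trans (Equiv.refl _) π ρ (Equiv.refl _)

theorem ofPerm_two : P.ofPerm 2 (finAddFlip : Fin (1 + 1) ≃ Fin (1 + 1)) = P.sigma := by
  have h : (finAddFlip : Fin (1 + 1) ≃ Fin (1 + 1)) = adjSwap 0 2 le_rfl := by
    ext i; fin_cases i <;> rfl
  rw [h, ofPerm_adjSwap, adj_last]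
  exact P.empty_tensor P.sigma

/-- The morphism given by a bijection of wires: the wire at position `i` goes to position `e i`. -/
def perm {a b : ℕ} (e : Fin a ≃ Fin b) : Hom a b :=
  castHom rfl (Fin.equiv_iff_eq.1 ⟨e⟩)
    (P.ofPerm a (e.trans (finCongr (Fin.equiv_iff_eq.1 ⟨e⟩).symm)))

theorem perm_refl (a : ℕ) : P.perm (Equiv.refl (Fin a)) = P.idn a := P.ofPerm_one a

theorem perm_comp {a b c : ℕ} (f : Fin b ≃ Fin c) (e : Fin a ≃ Fin b) :
    P.comp (P.perm f) (P.perm e) = P.perm (e.trans f) := by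
  obtain rfl := Fin.equiv_iff_eq.1 ⟨e⟩
  obtain rfl := Fin.equiv_iff_eq.1 ⟨f⟩
  exact (P.ofPerm_mul f e).symm

theorem perm_tensor {a b c d : ℕ} (e : Fin a ≃ Fin b) (f : Fin c ≃ Fin d) :
    P.tensor (P.perm e) (P.perm f) = P.perm (addPerm e f) := by
  obtain rfl := Fin.equiv_iff_eq.1 ⟨e⟩
  obtain rfl := Fin.equiv_iff_eq.1 ⟨f⟩
  exact (P.ofPerm_addPerm e f).symm

theorem perm_sigma : P.perm (finAddFlip : Fin (1 + 1) ≃ Fin (1 + 1)) = P.sigma := P.ofPerm_two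

/-- The nontrivial permutation of two wires. -/
def swapTwo : Fin 2 ≃ Fin 2 := natEquiv (1 - ·) (1 - ·) (by grind) (by grind)

@[simp] theorem swapTwo_val (i : Fin 2) : (swapTwo i : ℕ) = 1 - i := rfl

theorem perm_swapTwo : P.perm swapTwo = P.sigma := by
  rw [← perm_sigma]
  congr 1
  ext i; fin_cases i <;> rfl

theorem castHom_perm {a b a' b' : ℕ} (ha : a = a') (hb : b = b') (e : Fin a ≃ Fin b) :
    castHom ha hb (P.perm e) = P.perm ((finCongr ha.symm).trans (e.trans (finCongr hb))) := by
  subst ha hb; rfl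

/-- The composite of a morphism with permutations of its sources and of its targets. -/
def conj {a a' b b' : ℕ} (π : Fin a' ≃ Fin a) (f : Hom a b) (ρ : Fin b ≃ Fin b') : Hom a' b' :=
  P.comp (P.perm ρ) (P.comp f (P.perm π))

/-- Arity transports thereby become bijections of wires and are absorbed by the same calculus as the
symmetries. -/
theorem castHom_eq_conj {a b a' b' : ℕ} (ha : a = a') (hb : b = b') (f : Hom a b) :
    castHom ha hb f = P.conj (finCongr ha.symm) f (finCongr hb) := by
  subst ha hb
  have h (a : ℕ) : P.perm (finCongr (rfl : a = a)) = P.idn a := P.perm_refl a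
  rw [conj, h, h, P.comp_idn, P.idn_comp]
  rfl

theorem conj_conj {a a' a'' b b' b'' : ℕ} (π' : Fin a'' ≃ Fin a') (π : Fin a' ≃ Fin a)
    (f : Hom a b) (ρ : Fin b ≃ Fin b') (ρ' : Fin b' ≃ Fin b'') :
    P.conj π' (P.conj π f ρ) ρ' = P.conj (π'.trans π) f (ρ.trans ρ') := by
  simp only [conj, ← perm_comp, P.comp_assoc]

theorem conj_refl {a b : ℕ} (f : Hom a b) : P.conj (Equiv.refl _) f (Equiv.refl _) = f := by
  rw [conj, perm_refl, perm_refl, P.comp_idn, P.idn_comp]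

theorem conj_perm {a a' b b' : ℕ} (π : Fin a' ≃ Fin a) (e : Fin a ≃ Fin b) (ρ : Fin b ≃ Fin b') :
    P.conj π (P.perm e) ρ = P.perm (π.trans (e.trans ρ)) := by
  rw [conj, perm_comp, perm_comp, Equiv.trans_assoc]

theorem perm_comp_conj {a a' b b' c : ℕ} (e : Fin b' ≃ Fin c) (π : Fin a' ≃ Fin a) (f : Hom a b)
    (ρ : Fin b ≃ Fin b') : P.comp (P.perm e) (P.conj π f ρ) = P.conj π f (ρ.trans e) := by
  rw [conj, conj, ← P.comp_assoc, perm_comp]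

theorem conj_comp_perm {a a' b b' c : ℕ} (e : Fin c ≃ Fin a') (π : Fin a' ≃ Fin a) (f : Hom a b)
    (ρ : Fin b ≃ Fin b') : P.comp (P.conj π f ρ) (P.perm e) = P.conj (e.trans π) f ρ := by
  rw [conj, conj, P.comp_assoc, P.comp_assoc, perm_comp]

theorem perm_comp_eq {a b b' : ℕ} (e : Fin b ≃ Fin b') (f : Hom a b) :
    P.comp (P.perm e) f = P.conj (Equiv.refl _) f e := by
  rw [conj, perm_refl, P.comp_idn]

theorem comp_perm_eq {a a' b : ℕ} (e : Fin a' ≃ Fin a) (f : Hom a b) :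
    P.comp f (P.perm e) = P.conj e f (Equiv.refl _) := by
  rw [conj, perm_refl, P.idn_comp]

theorem conj_tensor_conj {a a' b b' c c' d d' : ℕ} (π : Fin a' ≃ Fin a) (f : Hom a b)
    (ρ : Fin b ≃ Fin b') (π' : Fin c' ≃ Fin c) (g : Hom c d) (ρ' : Fin d ≃ Fin d') :
    P.tensor (P.conj π f ρ) (P.conj π' g ρ') =
      P.conj (addPerm π π') (P.tensor f g) (addPerm ρ ρ') := by
  simp only [conj, P.interchange, perm_tensor]

theorem conj_tensor {a a' b b' c d : ℕ} (π : Fin a' ≃ Fin a) (f : Hom a b)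
    (ρ : Fin b ≃ Fin b') (g : Hom c d) :
    P.tensor (P.conj π f ρ) g =
      P.conj (addPerm π (Equiv.refl _)) (P.tensor f g) (addPerm ρ (Equiv.refl _)) := by
  rw [← conj_tensor_conj, conj_refl]

theorem tensor_conj {a b c c' d d' : ℕ} (f : Hom a b) (π : Fin c' ≃ Fin c) (g : Hom c d)
    (ρ : Fin d ≃ Fin d') :
    P.tensor f (P.conj π g ρ) =
      P.conj (addPerm (Equiv.refl _) π) (P.tensor f g) (addPerm (Equiv.refl _) ρ) := by
  rw [← conj_tensor_conj, conj_refl]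

theorem tensor_tensor_eq_conj {a b c d e i : ℕ} (f : Hom a b) (g : Hom c d) (h : Hom e i) :
    P.tensor (P.tensor f g) h =
      P.conj (finCongr (Nat.add_assoc _ _ _)) (P.tensor f (P.tensor g h))
        (finCongr (Nat.add_assoc _ _ _).symm) := by
  rw [← P.tensor_assoc, castHom_eq_conj P, conj_conj]
  exact (P.conj_refl _).symm

theorem empty_tensor_eq_conj {a b : ℕ} (f : Hom a b) :
    P.tensor P.empty f =
      P.conj (finCongr (Nat.zero_add _)) f (finCongr (Nat.zero_add _).symm) := by
  conv_rhs => rw [← P.empty_tensor f, castHom_eq_conj P, conj_conj]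
  exact (P.conj_refl _).symm

theorem sym_eq_perm (n : ℕ) : P.sym n = P.perm (finAddFlip : Fin (n + 1) ≃ Fin (1 + n)) := by
  induction n with
  | zero =>
    refine P.idn_one.symm.trans ((P.perm_refl 1).symm.trans ?_)
    congr 1
    ext i
    simp
  | succ n ih =>
    have h : P.sym (n + 1) = P.comp (P.tensorWire (P.sym n)) (P.idnSigma n) := rfl
    rw [h, ih, tensorWire, idnSigma, ← idn_one, ← perm_refl, ← perm_refl, ← perm_swapTwo,
      perm_tensor, perm_tensor]
    refine (P.perm_comp _ _).trans ?_
    congr 1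
    ext i
    simp
    split_ifs <;> omega

theorem symm_eq_perm (a b : ℕ) : P.symm a b = P.perm (finAddFlip : Fin (a + b) ≃ Fin (b + a)) := by
  induction b with
  | zero =>
    have h : P.symm a 0 = castHom rfl (Nat.zero_add a).symm (P.idn a) := rfl
    rw [h, ← perm_refl, castHom_perm]
    congr 1
    ext i
    refine Eq.trans ?_ (finAddFlip_val (a := a) (b := 0) i).symm
    simp
  | succ b ih =>
    have h : P.symm a (b + 1) = castHom rfl (Nat.add_assoc b 1 a).symm
      (P.comp (b := b + (a + 1)) (P.tensor (a := b) (b := b) (P.idn b) (P.sym a))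
        (P.tensor (a := a + b) (b := b + a) (P.symm a b) P.wire)) := rfl
    rw [h, ih, ← idn_one, sym_eq_perm, ← perm_refl, ← perm_refl,
      perm_tensor, perm_tensor]
    rw [P.perm_comp (b := b + (a + 1)), castHom_perm]
    congr 1
    ext i
    simp
    split_ifs <;> omega

end PropStr

/-! ### Block permutations -/

/-- The permutation exchanging the first block of `a` points and the last block of `c` points. -/
def blockFlip (a b c : ℕ) : Fin (a + b + c) ≃ Fin (c + b + a) :=
  natEquiv (fun i => if i < a then i + b + c else if i < a + b then i - a + c else i - (a + b))
    (fun i => if i < c then i + b + a else if i < c + b then i - c + a else i - (c + b))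
    (by grind) (by grind)

@[simp] theorem blockFlip_val {a b c : ℕ} (i : Fin (a + b + c)) : (blockFlip a b c i : ℕ) =
    if (i : ℕ) < a then i + b + c else if (i : ℕ) < a + b then i - a + c else i - (a + b) := rfl

/-- The permutation exchanging the two middle blocks. -/
def midSwap (a b c d : ℕ) : Fin (a + b + (c + d)) ≃ Fin (a + c + (b + d)) :=
  natEquiv (fun i => if i < a then i else if i < a + b then i + c else
      if i < a + b + c then i - b else i)
    (fun i => if i < a then i else if i < a + c then i + b else
      if i < a + b + c then i - c else i)
    (by grind) (by grind)

@[simp] theorem midSwap_val {a b c d : ℕ} (i : Fin (a + b + (c + d))) :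
    (midSwap a b c d i : ℕ) = if (i : ℕ) < a then (i : ℕ) else if (i : ℕ) < a + b then i + c else
      if (i : ℕ) < a + b + c then i - b else i := rfl

/-- The permutation of the sources of `N ⊗ M` in the composite of `[M, p]` and `[N, q]`. -/
def compPerm (q m p r : ℕ) : Fin (q + m + p + r) ≃ Fin (q + r + (p + m)) :=
  natEquiv (fun i => if i < q then i else if i < q + m then i + r + p else
      if i < q + m + p then i - m + r else i - m - p)
    (fun i => if i < q then i else if i < q + r then i + m + p else
      if i < q + r + p then i - r + m else i - r - p)
    (by grind) (by grind)

@[simp] theorem compPerm_val {q m p r : ℕ} (i : Fin (q + m + p + r)) :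
    (compPerm q m p r i : ℕ) = if (i : ℕ) < q then (i : ℕ) else if (i : ℕ) < q + m then i + r + p
      else if (i : ℕ) < q + m + p then i - m + r else i - m - p := rfl

/-- The exchange of `0` and `j + 1`. -/
def headSwap {a b : ℕ} (j : ℕ) (hj : j < a) (h : 1 + a = b) : Fin (1 + a) ≃ Fin b :=
  natEquiv (fun i => if i = 0 then j + 1 else if i = j + 1 then 0 else i)
    (fun i => if i = 0 then j + 1 else if i = j + 1 then 0 else i)
    (by grind) (by grind)

@[simp] theorem headSwap_val {a b : ℕ} (j : ℕ) (hj : j < a) (h : 1 + a = b) (i : Fin (1 + a)) :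
    (headSwap j hj h i : ℕ) = if (i : ℕ) = 0 then j + 1 else if (i : ℕ) = j + 1 then 0 else i :=
  rfl

/-- The exchange of the first block of `c` points with the block of `c` points starting at
`c + j`. -/
def headBlockSwap {b : ℕ} (c j : ℕ) (hj : j + c ≤ b) : Fin (c + b) ≃ Fin (c + b) :=
  natEquiv (fun i => if i < c then i + (c + j) else
      if c + j ≤ i ∧ i < c + j + c then i - (c + j) else i)
    (fun i => if i < c then i + (c + j) else
      if c + j ≤ i ∧ i < c + j + c then i - (c + j) else i)
    (by grind) (by grind)

@[simp] theorem headBlockSwap_val {b : ℕ} (c j : ℕ) (hj : j + c ≤ b) (i : Fin (c + b)) :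
    (headBlockSwap c j hj i : ℕ) = if (i : ℕ) < c then i + (c + j) else
      if c + j ≤ (i : ℕ) ∧ (i : ℕ) < c + j + c then i - (c + j) else (i : ℕ) := rfl

theorem finAddFlip_trans (a b : ℕ) :
    (finAddFlip : Fin (a + b) ≃ Fin (b + a)).trans finAddFlip = Equiv.refl _ := by
  ext i
  simp
  grind

/-- Conjugating a transposition by `ρ` relabels the points it exchanges. Hence the wire to be cut
can be named as an output of the box, before `ρ` is applied. -/
theorem headSwap_trans {b k : ℕ} (ρ : Fin b ≃ Fin k) (x : Fin b) :
    (addPerm (Equiv.refl (Fin 1)) ρ).trans (headSwap (ρ x) (ρ x).2 rfl) =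
      (headSwap x x.2 rfl).trans (addPerm (Equiv.refl (Fin 1)) ρ) := by
  ext i
  refine Fin.addCases (fun i => ?_) (fun i => ?_) i
  · simp [Nat.add_comm 1]
  · by_cases h : i = x
    · subst h
      simp [Nat.add_comm 1]
    · have h1 : (ρ i : ℕ) ≠ ρ x := fun hh => h (ρ.injective (Fin.ext hh))
      have h2 : (i : ℕ) ≠ x := fun hh => h (Fin.ext hh)
      have h3 : ¬ (1 + (i : ℕ) = x + 1) := by omega
      have h4 : ¬ (1 + (ρ i : ℕ) = ρ x + 1) := by omega
      simp [h3, h4]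

/-! ### Commutation of boxes, and diagrams with feedback -/

namespace PropStr

section

variable {Hom : ℕ → ℕ → Type u} (P : PropStr Hom)

theorem conj_congr {a a' b b' : ℕ} {π π' : Fin a' ≃ Fin a} {f f' : Hom a b}
    {ρ ρ' : Fin b ≃ Fin b'} (hπ : π = π') (hf : f = f') (hρ : ρ = ρ') :
    P.conj π f ρ = P.conj π' f' ρ' := by rw [hπ, hf, hρ]

theorem conj_comp_conj {a a' b b' c d d' : ℕ} (π : Fin a' ≃ Fin a) (f : Hom a b)
    (ρ : Fin b ≃ Fin b') (π' : Fin b' ≃ Fin c) (g : Hom c d) (ρ' : Fin d ≃ Fin d') :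
    P.comp (P.conj π' g ρ') (P.conj π f ρ) =
      P.conj π (P.comp g (P.conj (Equiv.refl _) f (ρ.trans π'))) ρ' := by
  simp only [conj, perm_refl, P.comp_idn, P.comp_assoc, ← perm_comp]

theorem conj_idn {a b c : ℕ} (π : Fin a ≃ Fin b) (ρ : Fin b ≃ Fin c) :
    P.conj π (P.idn b) ρ = P.perm (π.trans ρ) := by
  rw [conj, P.idn_comp, perm_comp]

theorem tensor_tensor_eq_conj' {a b c d e i : ℕ} (f : Hom a b) (g : Hom c d) (h : Hom e i) :
    P.tensor f (P.tensor g h) =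
      P.conj (finCongr (Nat.add_assoc _ _ _).symm) (P.tensor (P.tensor f g) h)
        (finCongr (Nat.add_assoc _ _ _)) := by
  rw [← P.tensor_assoc, castHom_eq_conj P]

/-- Naturality of `sym`, solved for `f ⊗ id` by cancelling the block exchange with its inverse.
Iterating over wires gives `tensor_idn_eq_conj`, and then boxes of any arity commute in
`tensor_swap`. -/
theorem tensor_wire_eq_conj {a b : ℕ} (f : Hom a b) :
    P.tensor f P.wire = P.conj finAddFlip (P.tensor P.wire f) finAddFlip := by
  have h := congrArg (P.comp (P.perm finAddFlip)) (P.sym_natural f)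
  rw [sym_eq_perm, sym_eq_perm, ← P.comp_assoc, perm_comp] at h
  rw [conj, ← h, finAddFlip_trans, perm_refl, P.idn_comp]

theorem tensor_idn_eq_conj {a b : ℕ} (f : Hom a b) (c : ℕ) :
    P.tensor f (P.idn c) = P.conj finAddFlip (P.tensor (P.idn c) f) finAddFlip := by
  induction c with
  | zero =>
    have h : P.tensor (P.idn 0) f = _ := P.empty_tensor_eq_conj f
    rw [h, conj_conj]
    refine (P.tensor_empty f).trans (Eq.trans (P.conj_refl f).symm ?_)
    refine P.conj_congr ?_ rfl ?_
    · ext i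
      refine Eq.trans ?_ (finAddFlip_val (a := a) (b := 0) i).symm
      simp
    · ext i
      refine Eq.trans ?_
        (finAddFlip_val (a := 0) (b := b) (Fin.cast (Nat.zero_add b).symm i)).symm
      simp
  | succ c ih =>
    have h : P.idn (c + 1) = P.tensor (P.idn c) P.wire := rfl
    rw [h, tensor_tensor_eq_conj' P f, ih, conj_tensor, tensor_tensor_eq_conj, tensor_wire_eq_conj,
      tensor_conj, tensor_tensor_eq_conj]
    simp only [conj_conj]
    refine P.conj_congr ?_ rfl ?_
    all_goals
      ext i
      simp
      grind

theorem tensor_swap {a b c d : ℕ} (f : Hom a b) (g : Hom c d) :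
    P.tensor f g = P.conj finAddFlip (P.tensor g f) finAddFlip := by
  have hg : P.tensor (P.idn a) g = P.conj finAddFlip (P.tensor g (P.idn a)) finAddFlip := by
    rw [tensor_idn_eq_conj, conj_conj]
    refine (P.conj_refl _).symm.trans (P.conj_congr ?_ rfl ?_)
    all_goals
      ext i
      simp
      grind
  rw [tensor_eq_comp, hg, tensor_idn_eq_conj, conj_comp_conj,
    finAddFlip_trans, conj_refl, ← tensor_eq_comp']

theorem blockSwap_eq_perm (a b c : ℕ) : P.blockSwap a b c = P.perm (blockFlip a b c) := by
  simp only [PropOps.blockSwap, symm_eq_perm, ← perm_refl, perm_tensor, castHom_perm, perm_comp]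
  congr 1
  ext i
  simp
  grind

end

variable {A : ℕ → ℕ → Type u} (P : PropStr A)

theorem compRep_eq_conj {p q r m n : ℕ} (M : A (p + m) (p + n)) (N : A (q + r) (q + m)) :
    compRep P M N = P.conj (compPerm q m p r) (P.tensor N M)
      (finCongr (by omega)) := by
  rw [compRep, blockSwap_eq_perm, ← perm_refl, perm_tensor, castHom_perm, comp_perm_eq,
    castHom_eq_conj P, conj_conj]
  refine P.conj_congr ?_ rfl rfl
  ext i
  simp
  grind

theorem tensorRep_eq_conj {p q m n m' n' : ℕ} (M : A (p + m) (p + n)) (N : A (q + m') (q + n')) :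
    tensorRep P M N = P.conj (midSwap p q m m') (P.tensor M N) (midSwap p n q n') := by
  simp only [tensorRep, symm_eq_perm, ← perm_refl, perm_tensor, comp_perm_eq, perm_comp_eq,
    castHom_eq_conj P, conj_conj]
  refine P.conj_congr ?_ rfl ?_
  all_goals
    ext i
    simp
    grind

theorem addWire_eq_conj {k n m : ℕ} (j r : ℕ) (h : k + m = j + 1 + r) (M : A (k + n) (k + m)) :
    addWire P j r h M = P.conj (finCongr (by omega)) (P.tensor P.wire M)
      (headSwap j (by omega) (by omega)) := by
  simp only [addWire, blockSwap_eq_perm, ← perm_refl, perm_tensor, perm_comp_eq,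
    castHom_eq_conj P, conj_conj]
  refine P.conj_congr ?_ rfl ?_
  all_goals
    ext i
    simp
    try grind

/-- The class of `F` with its sources and targets permuted by `π` and `ρ`, where the first `k`
sources and targets are traced. -/
def loopClass {a b n m : ℕ} (k : ℕ) (π : Fin (k + n) ≃ Fin a) (F : A a b)
    (ρ : Fin b ≃ Fin (k + m)) : TraceHom P n m :=
  traceClass P k (P.conj π F ρ)

theorem traceClass_eq_loopClass {k n m : ℕ} (M : A (k + n) (k + m)) :
    traceClass P k M = P.loopClass k (Equiv.refl _) M (Equiv.refl _) := by
  rw [loopClass, conj_refl]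

theorem loopClass_conj {a a' b b' n m k : ℕ} (π : Fin (k + n) ≃ Fin a') (π' : Fin a' ≃ Fin a)
    (F : A a b) (ρ' : Fin b ≃ Fin b') (ρ : Fin b' ≃ Fin (k + m)) :
    P.loopClass k π (P.conj π' F ρ') ρ = P.loopClass k (π.trans π') F (ρ'.trans ρ) := by
  rw [loopClass, conj_conj, loopClass]

theorem traceClass_slide {n m p q : ℕ} (M : A (q + n) (p + m)) (g : A p q) :
    traceClass P q (P.comp (P.tensor g (P.idn m)) M) =
      traceClass P p (P.comp M (P.tensor g (P.idn n))) :=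
  Quot.sound (TraceRel.slide p q M g)

/-- The sliding rule for the morphism `g = P.perm τ`: relabelling feedback wires simultaneously at
both ends leaves the class unchanged. Most of the laws below reduce to finding `τ`. -/
theorem loopClass_eq {a b n m k k' : ℕ} {π : Fin (k + n) ≃ Fin a} {F : A a b}
    {ρ : Fin b ≃ Fin (k + m)} {π' : Fin (k' + n) ≃ Fin a} {ρ' : Fin b ≃ Fin (k' + m)}
    (τ : Fin k ≃ Fin k') (hπ : (addPerm τ (Equiv.refl _)).trans π' = π)
    (hρ : ρ.trans (addPerm τ (Equiv.refl _)) = ρ') :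
    P.loopClass k π F ρ = P.loopClass k' π' F ρ' := by
  have h := P.traceClass_slide (P.conj π' F ρ) (P.perm τ)
  rw [← perm_refl, ← perm_refl, perm_tensor, perm_tensor, conj_comp_perm, perm_comp_conj,
    hπ, hρ] at h
  exact h.symm

/-- The box `g` may sit on any of the feedback wires: `τ` and `τ'` bring its wires to the front, and
the other `x` wires are carried along by sliding `g ⊗ id`. -/
theorem loopClass_slide {a b n m p q x K K' : ℕ} (g : A p q) (F : A (q + a) (p + b))
    (π₀ : Fin (x + n) ≃ Fin a) (ρ₀ : Fin b ≃ Fin (x + m)) (τ : Fin K ≃ Fin (q + x))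
    (τ' : Fin K' ≃ Fin (p + x)) {π : Fin (K + n) ≃ Fin (q + a)} {ρ : Fin (q + b) ≃ Fin (K + m)}
    {π' : Fin (K' + n) ≃ Fin (p + a)} {ρ' : Fin (p + b) ≃ Fin (K' + m)}
    (hπ : (addPerm τ (Equiv.refl _)).trans ((finCongr (Nat.add_assoc _ _ _)).trans
      (addPerm (Equiv.refl _) π₀)) = π)
    (hρ : ρ.trans (addPerm τ (Equiv.refl _)) =
      (addPerm (Equiv.refl _) ρ₀).trans (finCongr (Nat.add_assoc _ _ _).symm))
    (hπ' : (addPerm τ' (Equiv.refl _)).trans ((finCongr (Nat.add_assoc _ _ _)).trans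
      (addPerm (Equiv.refl _) π₀)) = π')
    (hρ' : ρ'.trans (addPerm τ' (Equiv.refl _)) =
      (addPerm (Equiv.refl _) ρ₀).trans (finCongr (Nat.add_assoc _ _ _).symm)) :
    P.loopClass K π (P.comp (P.tensor g (P.idn b)) F) ρ =
      P.loopClass K' π' (P.comp F (P.tensor g (P.idn a))) ρ' := by
  rw [P.loopClass_eq τ hπ hρ, P.loopClass_eq τ' hπ' hρ']
  have h := P.traceClass_slide (n := n) (m := m)
    (P.conj ((finCongr (Nat.add_assoc _ _ _)).trans (addPerm (Equiv.refl _) π₀)) F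
      ((addPerm (Equiv.refl _) ρ₀).trans (finCongr (Nat.add_assoc _ _ _).symm)))
    (P.tensor g (P.idn x))
  -- A permutation of the wires beside `g` can be undone on the other side of `g`, since they carry
  -- the identity.
  have e {y z : ℕ} (σ : Fin z ≃ Fin (x + y)) : P.tensor (P.tensor g (P.idn x)) (P.idn y) =
      P.conj ((finCongr (Nat.add_assoc _ _ _)).trans (addPerm (Equiv.refl _) σ.symm))
        (P.tensor g (P.idn z))
        ((addPerm (Equiv.refl _) σ).trans (finCongr (Nat.add_assoc _ _ _).symm)) := by
    rw [tensor_tensor_eq_conj, idn_tensor_idn, ← conj_conj, ← tensor_conj, conj_idn,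
      Equiv.symm_trans_self, perm_refl]
  have e' (y z z' w : ℕ) (σ : Fin z ≃ Fin z') (h : y + z' = w) (h' : w = y + z') :
      ((addPerm (Equiv.refl (Fin y)) σ).trans (finCongr h)).trans ((finCongr h').trans
        (addPerm (Equiv.refl _) σ.symm)) = Equiv.refl _ := by
    rw [Equiv.trans_assoc, ← Equiv.trans_assoc (finCongr h)]
    have : (finCongr h).trans (finCongr h') = Equiv.refl _ := by ext; simp
    rw [this, Equiv.refl_trans, ← addPerm_trans, Equiv.self_trans_symm, Equiv.refl_trans,
      addPerm_refl]
  rw [e ρ₀, e π₀.symm, conj_comp_conj, conj_comp_conj, e', conj_refl] at h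
  have e'' : ((addPerm (Equiv.refl _) π₀.symm).trans (finCongr (Nat.add_assoc q x n).symm)).trans
      ((finCongr (Nat.add_assoc q x n)).trans (addPerm (Equiv.refl _) π₀)) = Equiv.refl _ :=
    e' q _ _ _ π₀.symm _ _
  rw [e''] at h
  rw [loopClass, loopClass, h, Equiv.symm_symm]
  congr 1
  simp only [conj, perm_refl, P.comp_idn, P.idn_comp, P.comp_assoc]

/-- The wire-adding rule for an arbitrary output `x` of `F`: the rule asks for a position among the
final outputs, which is `ρ x`, and `headSwap_trans` moves the exchange back across `ρ`. -/
theorem loopClass_addWire {a b n m k : ℕ} (π : Fin (k + n) ≃ Fin a) (F : A a b)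
    (ρ : Fin b ≃ Fin (k + m)) (x : Fin b) :
    P.loopClass k π F ρ = P.loopClass (1 + k)
      ((finCongr (Nat.add_assoc _ _ _)).trans (addPerm (Equiv.refl (Fin 1)) π))
      (P.tensor P.wire F) ((headSwap x x.2 rfl).trans
        ((addPerm (Equiv.refl (Fin 1)) ρ).trans (finCongr (Nat.add_assoc _ _ _).symm))) := by
  have h : traceClass P k (P.conj π F ρ) = _ :=
    Quot.sound (TraceRel.addWire k (ρ x) (k + m - (ρ x + 1)) (by omega) (P.conj π F ρ))
  rw [loopClass, h]
  change traceClass P (k + 1) _ = _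
  rw [addWire_eq_conj, tensor_conj, conj_conj]
  refine P.loopClass_eq (finCongr (Nat.add_comm k 1)) ?_ ?_
  · ext i
    simp
    grind
  · rw [← Equiv.trans_assoc (headSwap _ _ _), ← headSwap_trans ρ x]
    ext i
    simp
    grind

end PropStr

/-- The exchange of the first two blocks. -/
def leftSwap (a b c : ℕ) : Fin (a + (b + c)) ≃ Fin (b + (a + c)) :=
  natEquiv (fun i => if i < a then i + b else if i < a + b then i - a else i)
    (fun i => if i < b then i + a else if i < a + b then i - b else i) (by grind) (by grind)

@[simp] theorem leftSwap_val {a b c : ℕ} (i : Fin (a + (b + c))) : (leftSwap a b c i : ℕ) =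
    if (i : ℕ) < a then i + b else if (i : ℕ) < a + b then i - a else i := rfl

/-! ### Adding and sliding several wires; composition of classes -/

namespace PropStr

variable {A : ℕ → ℕ → Type u} (P : PropStr A)

theorem loopClass_addWires {a b n m k : ℕ} (c : ℕ) (π : Fin (k + n) ≃ Fin a) (F : A a b)
    (ρ : Fin b ≃ Fin (k + m)) (j : ℕ) (hj : j + c ≤ b) :
    P.loopClass k π F ρ = P.loopClass (c + k)
      ((finCongr (Nat.add_assoc _ _ _)).trans (addPerm (Equiv.refl (Fin c)) π))
      (P.tensor (P.idn c) F) ((headBlockSwap c j hj).trans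
        ((addPerm (Equiv.refl (Fin c)) ρ).trans (finCongr (Nat.add_assoc _ _ _).symm))) := by
  induction c generalizing a b k j with
  | zero =>
    have h : P.tensor (P.idn 0) F = _ := P.empty_tensor_eq_conj F
    rw [h, loopClass_conj]
    refine P.loopClass_eq (finCongr (Nat.zero_add k).symm) ?_ ?_
    · ext i
      simp
      grind
    · ext i
      simp
      grind
  | succ c ih =>
    have h : P.idn (c + 1) = P.tensor (P.idn c) P.wire := rfl
    -- The wire added first ends up last among the new ones, so it cuts the last output `j + c` of
    -- the block. It also shifts the outputs of `F` by one, whence `j + 1` for the remaining wires.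
    rw [P.loopClass_addWire π F ρ ⟨j + c, by omega⟩, ih _ _ _ (j + 1) (by omega), h,
      tensor_tensor_eq_conj, loopClass_conj]
    refine P.loopClass_eq (finCongr (by omega)) ?_ ?_
    · ext i
      simp
      grind
    · ext i
      simp
      grind

/-- Sliding in the presence of a second box `X`, as needed when one factor of a composite or tensor
product changes its representative. -/
theorem loopClass_slide_tensor {a b n m n' m' p q x K K' : ℕ} (g : A p q)
    (M : A (q + n') (p + m')) (X : A a b)
    (π₀ : Fin (x + n) ≃ Fin (n' + a)) (ρ₀ : Fin (m' + b) ≃ Fin (x + m)) (τ : Fin K ≃ Fin (q + x))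
    (τ' : Fin K' ≃ Fin (p + x)) {π : Fin (K + n) ≃ Fin (q + n' + a)}
    {ρ : Fin (q + m' + b) ≃ Fin (K + m)}
    {π' : Fin (K' + n) ≃ Fin (p + n' + a)} {ρ' : Fin (p + m' + b) ≃ Fin (K' + m)}
    (hπ : (addPerm τ (Equiv.refl _)).trans ((finCongr (Nat.add_assoc _ _ _)).trans
      (addPerm (Equiv.refl _) π₀)) = π.trans (finCongr (Nat.add_assoc _ _ _)))
    (hρ : ρ.trans (addPerm τ (Equiv.refl _)) = (finCongr (Nat.add_assoc _ _ _)).trans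
      ((addPerm (Equiv.refl _) ρ₀).trans (finCongr (Nat.add_assoc _ _ _).symm)))
    (hπ' : (addPerm τ' (Equiv.refl _)).trans ((finCongr (Nat.add_assoc _ _ _)).trans
      (addPerm (Equiv.refl _) π₀)) = π'.trans (finCongr (Nat.add_assoc _ _ _)))
    (hρ' : ρ'.trans (addPerm τ' (Equiv.refl _)) = (finCongr (Nat.add_assoc _ _ _)).trans
      ((addPerm (Equiv.refl _) ρ₀).trans (finCongr (Nat.add_assoc _ _ _).symm))) :
    P.loopClass K π (P.tensor (P.comp (P.tensor g (P.idn m')) M) X) ρ =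
      P.loopClass K' π' (P.tensor (P.comp M (P.tensor g (P.idn n'))) X) ρ' := by
  have e1 : P.tensor (P.comp (P.tensor g (P.idn m')) M) X =
      P.conj (finCongr (Nat.add_assoc _ _ _))
        (P.comp (P.tensor g (P.idn (m' + b))) (P.conj (finCongr (Nat.add_assoc _ _ _).symm)
          (P.tensor M X) (finCongr (Nat.add_assoc _ _ _))))
        (finCongr (Nat.add_assoc _ _ _).symm) := by
    rw [← P.idn_comp X, P.interchange, tensor_tensor_eq_conj, idn_tensor_idn, P.idn_comp]
    simp only [conj, P.comp_assoc, perm_comp]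
    refine congrArg _ (congrArg _ (congrArg _ ?_))
    exact (P.comp_idn _).symm.trans (congrArg _ (P.perm_refl _).symm)
  have e2 : P.tensor (P.comp M (P.tensor g (P.idn n'))) X =
      P.conj (finCongr (Nat.add_assoc _ _ _))
        (P.comp (P.conj (finCongr (Nat.add_assoc _ _ _).symm)
          (P.tensor M X) (finCongr (Nat.add_assoc _ _ _))) (P.tensor g (P.idn (n' + a))))
        (finCongr (Nat.add_assoc _ _ _).symm) := by
    rw [← P.comp_idn X, P.interchange, tensor_tensor_eq_conj, idn_tensor_idn, P.comp_idn]
    simp only [conj, ← P.comp_assoc, perm_comp]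
    refine congrArg (P.comp · _) (congrArg (P.comp · _) (congrArg (P.comp · _) ?_))
    exact (P.idn_comp _).symm.trans (congrArg (P.comp · _) (P.perm_refl _).symm)
  rw [e1, e2, loopClass_conj, loopClass_conj]
  refine P.loopClass_slide g _ π₀ ρ₀ τ τ' hπ ?_ hπ' ?_
  · rw [Equiv.trans_assoc, hρ]
    ext i; simp
  · rw [Equiv.trans_assoc, hρ']
    ext i; simp

/-- Composition of classes. -/
def compClass {r m n : ℕ} (f : TraceHom P m n) (g : TraceHom P r m) : TraceHom P r n :=
  Quot.lift₂ (fun M N => traceClass P (N.1 + m + M.1) (compRep P M.2 N.2))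
    (by
      rintro ⟨s, M⟩ _ _ (⟨p, q, N, g⟩ | ⟨k, j, i, h, N⟩)
      · change traceClass P _ (compRep P M _) = traceClass P _ (compRep P M _)
        rw [compRep_eq_conj, compRep_eq_conj]
        -- The feedback wires not touched by `g` are the `m` connecting wires and the `s` feedback
        -- wires of `M`.
        refine P.loopClass_slide_tensor g N M (x := m + s)
          ((blockFlip m s r).trans (finCongr (Nat.add_assoc _ _ _)))
          (finCongr (Nat.add_assoc _ _ _).symm)
          (finCongr (Nat.add_assoc _ _ _)) (finCongr (Nat.add_assoc _ _ _)) ?_ ?_ ?_ ?_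
        all_goals
          ext i
          simp
          try grind
      · change traceClass P _ (compRep P M _) = traceClass P _ (compRep P M _)
        rw [compRep_eq_conj, compRep_eq_conj, addWire_eq_conj, conj_tensor, conj_conj,
          tensor_tensor_eq_conj, conj_conj]
        refine (P.loopClass_addWire _ _ _ (⟨j, by omega⟩ : Fin (k + m + (s + n)))).trans ?_
        refine P.loopClass_eq (finCongr (by simp; omega)) ?_ ?_
        all_goals
          ext i
          simp
          grind)
    (by
      rintro _ _ ⟨s, N⟩ (⟨p, q, M, g⟩ | ⟨k, j, i, h, M⟩)
      · change traceClass P _ (compRep P _ N) = traceClass P _ (compRep P _ N)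
        rw [compRep_eq_conj, compRep_eq_conj, P.tensor_swap N, P.tensor_swap N, conj_conj,
          conj_conj]
        refine P.loopClass_slide_tensor g M N (x := s + m)
          ((finCongr (Nat.add_assoc _ _ _)).trans (leftSwap s m r))
          finAddFlip finAddFlip finAddFlip ?_ ?_ ?_ ?_
        all_goals
          ext i
          simp
          grind
      · change traceClass P _ (compRep P _ N) = traceClass P _ (compRep P _ N)
        rw [compRep_eq_conj, compRep_eq_conj, P.tensor_swap N, P.tensor_swap N, conj_conj,
          addWire_eq_conj, conj_tensor, tensor_tensor_eq_conj, conj_conj, conj_conj, conj_conj]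
        refine (P.loopClass_addWire _ _ _ (⟨j, by omega⟩ : Fin (k + n + (s + m)))).trans ?_
        -- The new wire is created in front and has to move past the `s + m` wires that precede the
        -- feedback wires of `M`.
        refine P.loopClass_eq ((leftSwap 1 (s + m) k).trans
          (finCongr (by omega : s + m + (1 + k) = s + m + (k + 1)))) ?_ ?_
        all_goals
          ext i
          simp
          grind) f g

end PropStr

/-! ### Tensor product and trace of classes; associativity, interchange and units -/

namespace PropStr

variable {A : ℕ → ℕ → Type u} (P : PropStr A)

/-- The tensor product of classes. -/
def tensorClass {m n m' n' : ℕ} (f : TraceHom P m n) (g : TraceHom P m' n') :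
    TraceHom P (m + m') (n + n') :=
  Quot.lift₂ (fun M N => traceClass P (M.1 + N.1) (tensorRep P M.2 N.2))
    (by
      rintro ⟨s, M⟩ _ _ (⟨p, q, N, g⟩ | ⟨k, j, i, h, N⟩)
      · change traceClass P _ (tensorRep P M _) = traceClass P _ (tensorRep P M _)
        rw [tensorRep_eq_conj, tensorRep_eq_conj, P.tensor_swap M, P.tensor_swap M, conj_conj,
          conj_conj]
        refine P.loopClass_slide_tensor g N M (x := s)
          ((finCongr (Nat.add_assoc _ _ _).symm).trans finAddFlip)
          (finAddFlip.trans (finCongr (Nat.add_assoc _ _ _)))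
          finAddFlip finAddFlip ?_ ?_ ?_ ?_
        all_goals
          ext i
          simp
          grind (splits := 30)
      · change traceClass P _ (tensorRep P M _) = traceClass P _ (tensorRep P M _)
        rw [tensorRep_eq_conj, tensorRep_eq_conj, P.tensor_swap M, P.tensor_swap M, conj_conj,
          addWire_eq_conj, conj_tensor, tensor_tensor_eq_conj, conj_conj, conj_conj, conj_conj]
        refine (P.loopClass_addWire _ _ _ (⟨j, by omega⟩ : Fin (k + n' + (s + n)))).trans ?_
        refine P.loopClass_eq ((leftSwap 1 s k).trans
          (finCongr (by omega : s + (1 + k) = s + (k + 1)))) ?_ ?_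
        all_goals
          ext i
          simp
          grind (splits := 30))
    (by
      rintro _ _ ⟨s, N⟩ (⟨p, q, M, g⟩ | ⟨k, j, i, h, M⟩)
      · change traceClass P _ (tensorRep P _ N) = traceClass P _ (tensorRep P _ N)
        rw [tensorRep_eq_conj, tensorRep_eq_conj]
        refine P.loopClass_slide_tensor g M N (x := s)
          (leftSwap s m m') (leftSwap n s n') (Equiv.refl _) (Equiv.refl _) ?_ ?_ ?_ ?_
        all_goals
          ext i
          simp
          grind (splits := 30)
      · change traceClass P _ (tensorRep P _ N) = traceClass P _ (tensorRep P _ N)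
        rw [tensorRep_eq_conj, tensorRep_eq_conj, addWire_eq_conj, conj_tensor,
          tensor_tensor_eq_conj, conj_conj, conj_conj]
        refine (P.loopClass_addWire _ _ _ (⟨j, by omega⟩ : Fin (k + n + (s + n')))).trans ?_
        refine P.loopClass_eq (finCongr (by omega : 1 + (k + s) = k + 1 + s)) ?_ ?_
        all_goals
          ext i
          simp
          grind (splits := 30)) f g

/-- The trace of a class. -/
def traceOp {m n : ℕ} (f : TraceHom P (1 + m) (1 + n)) : TraceHom P m n :=
  Quot.lift (fun M => traceClass P (M.1 + 1)
      (castHom (Nat.add_assoc M.1 1 m).symm (Nat.add_assoc M.1 1 n).symm M.2))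
    (by
      rintro _ _ (⟨p, q, N, g⟩ | ⟨k, j, i, h, N⟩)
      · dsimp only
        rw [castHom_eq_conj P, castHom_eq_conj P]
        refine P.loopClass_slide g N (x := 1) (Equiv.refl _) (Equiv.refl _)
          (Equiv.refl _) (Equiv.refl _) ?_ ?_ ?_ ?_
        all_goals
          ext i
          simp
          try grind (splits := 30)
      · dsimp only
        rw [castHom_eq_conj P, castHom_eq_conj P, addWire_eq_conj, conj_conj]
        refine (P.loopClass_addWire _ _ _ (⟨j, by omega⟩ : Fin (k + (1 + n)))).trans ?_
        refine P.loopClass_eq (finCongr (by omega : 1 + (k + 1) = k + 1 + 1)) ?_ ?_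
        all_goals
          ext i
          simp
          try grind (splits := 30)) f

theorem exists_traceClass {m n : ℕ} (f : TraceHom P m n) : ∃ k M, f = traceClass P k M := by
  obtain ⟨⟨k, M⟩, rfl⟩ := Quot.exists_rep f
  exact ⟨k, M, rfl⟩

theorem compClass_loopClass {a b c d p q r m n : ℕ} (π : Fin (p + m) ≃ Fin a) (M : A a b)
    (ρ : Fin b ≃ Fin (p + n)) (π' : Fin (q + r) ≃ Fin c) (N : A c d) (ρ' : Fin d ≃ Fin (q + m)) :
    P.compClass (P.loopClass p π M ρ) (P.loopClass q π' N ρ') = P.loopClass (q + m + p)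
      ((compPerm q m p r).trans (addPerm π' π)) (P.tensor N M)
      ((addPerm ρ' ρ).trans (finCongr (by omega))) := by
  change traceClass P _ (compRep P _ _) = _
  rw [compRep_eq_conj, conj_tensor_conj, conj_conj, loopClass]

theorem tensorClass_loopClass {a b c d p q m n m' n' : ℕ} (π : Fin (p + m) ≃ Fin a) (M : A a b)
    (ρ : Fin b ≃ Fin (p + n)) (π' : Fin (q + m') ≃ Fin c) (N : A c d)
    (ρ' : Fin d ≃ Fin (q + n')) :
    P.tensorClass (P.loopClass p π M ρ) (P.loopClass q π' N ρ') = P.loopClass (p + q)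
      ((midSwap p q m m').trans (addPerm π π')) (P.tensor M N)
      ((addPerm ρ ρ').trans (midSwap p n q n')) := by
  change traceClass P _ (tensorRep P _ _) = _
  rw [tensorRep_eq_conj, conj_tensor_conj, conj_conj, loopClass]

theorem traceOp_loopClass {a b k m n : ℕ} (π : Fin (k + (1 + m)) ≃ Fin a) (M : A a b)
    (ρ : Fin b ≃ Fin (k + (1 + n))) :
    P.traceOp (P.loopClass k π M ρ) = P.loopClass (k + 1)
      ((finCongr (Nat.add_assoc k 1 m)).trans π) M
      (ρ.trans (finCongr (Nat.add_assoc k 1 n).symm)) := by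
  change traceClass P _ (castHom _ _ _) = _
  rw [castHom_eq_conj P, conj_conj, loopClass]

theorem castHom_loopClass {a b k n m n' m' : ℕ} (hn : n = n') (hm : m = m')
    (π : Fin (k + n) ≃ Fin a) (F : A a b) (ρ : Fin b ≃ Fin (k + m)) :
    castHom hn hm (P.loopClass k π F ρ) = P.loopClass k
      ((finCongr (by rw [hn])).trans π) F (ρ.trans (finCongr (by rw [hm]))) := by
  subst hn hm; rfl

theorem ofProp_eq_loopClass {n m : ℕ} (f : A n m) : ofProp P f =
    P.loopClass 0 (finCongr (Nat.zero_add n)) f (finCongr (Nat.zero_add m).symm) := by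
  rw [ofProp, castHom_eq_conj P, loopClass]

theorem tensor_empty_eq_conj {a b : ℕ} (f : A a b) : P.tensor f P.empty =
    P.conj (finCongr (Nat.add_zero a)) f (finCongr (Nat.add_zero b).symm) :=
  (P.tensor_empty f).trans (P.conj_refl f).symm

/-- Feedback wires are listed in the order in which the composite is traversed, so both bracketings
produce the same list and the same boxes. -/
theorem compClass_assoc {a b c d : ℕ} (f : TraceHom P c d) (g : TraceHom P b c)
    (h : TraceHom P a b) :
    P.compClass (P.compClass f g) h = P.compClass f (P.compClass g h) := by
  obtain ⟨p, M, rfl⟩ := P.exists_traceClass f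
  obtain ⟨q, N, rfl⟩ := P.exists_traceClass g
  obtain ⟨r, L, rfl⟩ := P.exists_traceClass h
  simp only [traceClass_eq_loopClass, compClass_loopClass]
  rw [tensor_tensor_eq_conj, loopClass_conj]
  refine P.loopClass_eq (finCongr (by omega)) ?_ ?_
  all_goals
    ext i
    simp
    grind (splits := 30)

theorem tensorClass_assoc {a b c d e i : ℕ} (f : TraceHom P a b) (g : TraceHom P c d)
    (h : TraceHom P e i) :
    castHom (Nat.add_assoc a c e) (Nat.add_assoc b d i) (P.tensorClass (P.tensorClass f g) h) =
      P.tensorClass f (P.tensorClass g h) := by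
  obtain ⟨p, M, rfl⟩ := P.exists_traceClass f
  obtain ⟨q, N, rfl⟩ := P.exists_traceClass g
  obtain ⟨r, L, rfl⟩ := P.exists_traceClass h
  simp only [traceClass_eq_loopClass, tensorClass_loopClass]
  rw [castHom_loopClass, tensor_tensor_eq_conj, loopClass_conj]
  refine P.loopClass_eq (finCongr (by omega)) ?_ ?_
  all_goals
    ext i
    simp
    grind (splits := 30)

theorem tensor_mid_swap {a b c d a' b' c' d' : ℕ} (f : A a a') (g : A b b') (h : A c c')
    (k : A d d') : P.tensor (P.tensor f g) (P.tensor h k) =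
      P.conj (midSwap a b c d) (P.tensor (P.tensor f h) (P.tensor g k)) (midSwap a' c' b' d') := by
  rw [tensor_tensor_eq_conj, tensor_tensor_eq_conj' P g, P.tensor_swap g h, conj_tensor,
    tensor_tensor_eq_conj P h g, conj_conj, conj_conj, tensor_conj,
    tensor_tensor_eq_conj' P f h, conj_conj, conj_conj]
  refine P.conj_congr ?_ rfl ?_
  all_goals
    ext i
    simp
    grind (splits := 30)

theorem interchangeClass {a b c d e i : ℕ} (f : TraceHom P b c) (g : TraceHom P a b)
    (h : TraceHom P e i) (k : TraceHom P d e) :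
    P.tensorClass (P.compClass f g) (P.compClass h k) =
      P.compClass (P.tensorClass f h) (P.tensorClass g k) := by
  obtain ⟨p, M, rfl⟩ := P.exists_traceClass f
  obtain ⟨q, N, rfl⟩ := P.exists_traceClass g
  obtain ⟨r, L, rfl⟩ := P.exists_traceClass h
  obtain ⟨s, K, rfl⟩ := P.exists_traceClass k
  simp only [traceClass_eq_loopClass, compClass_loopClass, tensorClass_loopClass]
  rw [tensor_mid_swap, loopClass_conj]
  -- One side lists feedback wires composite by composite, the other lists sources, connections and
  -- targets of both composites together.
  refine P.loopClass_eq ((midSwap (q + b) p (s + e) r).trans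
    ((addPerm (midSwap q b s e) (Equiv.refl _)))) ?_ ?_
  all_goals
    ext i
    simp
    grind (splits := 30)

theorem tensorClass_empty {a b : ℕ} (f : TraceHom P a b) :
    castHom (Nat.add_zero a) (Nat.add_zero b) (P.tensorClass f (ofProp P P.empty)) = f := by
  obtain ⟨p, M, rfl⟩ := P.exists_traceClass f
  rw [ofProp_eq_loopClass, traceClass_eq_loopClass, tensorClass_loopClass, castHom_loopClass,
    tensor_empty_eq_conj, loopClass_conj]
  refine P.loopClass_eq (finCongr (Nat.add_zero p)) ?_ ?_
  all_goals
    ext i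
    simp only [Equiv.trans_apply, Equiv.refl_apply, addPerm_val, finCongr_apply, Fin.val_cast,
      finAddFlip_val, midSwap_val, compPerm_val, headBlockSwap_val, blockFlip_val, dite_eq_ite]
    grind (splits := 30)

theorem empty_tensorClass {a b : ℕ} (f : TraceHom P a b) :
    castHom (Nat.zero_add a) (Nat.zero_add b) (P.tensorClass (ofProp P P.empty) f) = f := by
  obtain ⟨p, M, rfl⟩ := P.exists_traceClass f
  rw [ofProp_eq_loopClass, traceClass_eq_loopClass, tensorClass_loopClass, castHom_loopClass,
    empty_tensor_eq_conj, loopClass_conj]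
  refine P.loopClass_eq (finCongr (Nat.zero_add p)) ?_ ?_
  all_goals
    ext i
    simp only [Equiv.trans_apply, Equiv.refl_apply, addPerm_val, finCongr_apply, Fin.val_cast,
      finAddFlip_val, midSwap_val, compPerm_val, headBlockSwap_val, blockFlip_val, dite_eq_ite]
    grind (splits := 30)

theorem ofProp_tensor {a b c d : ℕ} (f : A a b) (g : A c d) :
    ofProp P (P.tensor f g) = P.tensorClass (ofProp P f) (ofProp P g) := by
  simp only [ofProp_eq_loopClass, tensorClass_loopClass]
  refine P.loopClass_eq (finCongr (Nat.add_zero 0).symm) ?_ ?_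
  all_goals
    ext i
    simp only [Equiv.trans_apply, Equiv.refl_apply, addPerm_val, finCongr_apply, Fin.val_cast,
      finAddFlip_val, midSwap_val, compPerm_val, headBlockSwap_val, blockFlip_val, dite_eq_ite]
    grind (splits := 30)

theorem idn_compClass {a b : ℕ} (f : TraceHom P a b) :
    P.compClass (ofProp P (P.idn b)) f = f := by
  obtain ⟨q, N, rfl⟩ := P.exists_traceClass f
  rw [ofProp_eq_loopClass, traceClass_eq_loopClass, compClass_loopClass]
  -- Cutting the `b` external outputs of `N`, which start at position `q`, yields exactly the
  -- composite with the identity.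
  refine Eq.symm ((P.loopClass_addWires b _ N _ q le_rfl).trans ?_)
  rw [tensor_swap, loopClass_conj]
  refine P.loopClass_eq finAddFlip ?_ ?_
  all_goals
    ext i
    simp only [Equiv.trans_apply, Equiv.refl_apply, addPerm_val, finCongr_apply, Fin.val_cast,
      finAddFlip_val, midSwap_val, compPerm_val, headBlockSwap_val, blockFlip_val, dite_eq_ite]
    grind (splits := 30)

theorem compClass_idn {a b : ℕ} (f : TraceHom P a b) :
    P.compClass f (ofProp P (P.idn a)) = f := by
  obtain ⟨p, M, rfl⟩ := P.exists_traceClass f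
  -- All outputs of `M` are cut. Now `M` stands at the end of the diagram on feedback wires only,
  -- ready to be slid.
  have h1 : traceClass P p M = P.loopClass (p + b + p) (finCongr (Nat.add_assoc _ _ _))
      (P.comp (P.tensor M (P.idn (p + b)))
        (P.perm (finAddFlip : Fin (p + b + (p + a)) ≃ Fin (p + a + (p + b)))))
      (finCongr (Nat.add_assoc _ _ _).symm) := by
    rw [traceClass_eq_loopClass, P.loopClass_addWires (p + b) _ M _ 0 (by omega), tensor_swap,
      loopClass_conj, comp_perm_eq, loopClass_conj]
    refine P.loopClass_eq (Equiv.refl _) ?_ ?_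
    all_goals
      ext i
      simp only [Equiv.trans_apply, Equiv.refl_apply, addPerm_val, finCongr_apply, Fin.val_cast,
        finAddFlip_val, midSwap_val, compPerm_val, headBlockSwap_val, blockFlip_val, dite_eq_ite]
      grind (splits := 30)
  -- Sliding `M` to the start turns the cut at its outputs into a cut at its inputs.
  have h2 : traceClass P p M = P.loopClass (p + a + p) (finCongr (Nat.add_assoc _ _ _))
      (P.comp (P.perm (finAddFlip : Fin (p + b + (p + a)) ≃ Fin (p + a + (p + b))))
        (P.tensor M (P.idn (p + a))))
      (finCongr (Nat.add_assoc _ _ _).symm) := by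
    rw [h1]
    refine P.loopClass_slide M _ (x := p) (Equiv.refl _) (Equiv.refl _) (Equiv.refl _)
      (Equiv.refl _) ?_ ?_ ?_ ?_
    all_goals
      ext i
      simp only [Equiv.trans_apply, Equiv.refl_apply, addPerm_val, finCongr_apply, Fin.val_cast,
        finAddFlip_val, midSwap_val, compPerm_val, headBlockSwap_val, blockFlip_val, dite_eq_ite]
      grind (splits := 30)
  refine Eq.trans ?_ h2.symm
  -- The composite has already cut the `a` external inputs of `M`; cutting its `p` feedback outputs
  -- as well, which start at position `a` after the identity wires, reaches the form of `h2`.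
  rw [ofProp_eq_loopClass, traceClass_eq_loopClass, compClass_loopClass,
    P.loopClass_addWires p _ _ _ a (by omega), tensor_tensor_eq_conj', idn_tensor_idn,
    P.tensor_swap (P.idn _), conj_conj, loopClass_conj, perm_comp_eq, loopClass_conj]
  refine P.loopClass_eq ((finCongr (by omega)).trans (blockFlip p a p)) ?_ ?_
  all_goals
    ext i
    simp only [Equiv.trans_apply, Equiv.refl_apply, addPerm_val, finCongr_apply, Fin.val_cast,
      finAddFlip_val, midSwap_val, compPerm_val, headBlockSwap_val, blockFlip_val, dite_eq_ite]
    grind (splits := 30)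

end PropStr

/-! ### The traced prop axioms for classes -/

namespace PropStr

variable {A : ℕ → ℕ → Type u} (P : PropStr A)

theorem tensor_left_swap {a b c d e i : ℕ} (f : A a b) (g : A c d) (h : A e i) :
    P.tensor f (P.tensor g h) =
      P.conj (leftSwap a c e) (P.tensor g (P.tensor f h)) (leftSwap d b i) := by
  rw [tensor_tensor_eq_conj', P.tensor_swap f g, conj_tensor, tensor_tensor_eq_conj, conj_conj,
    conj_conj]
  refine P.conj_congr ?_ rfl ?_
  all_goals
    ext i
    simp
    grind

/-- The composite of classes has `b` feedback wires between `g` and `f`. Sliding `g` along them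
leaves `f ∘ g` with `a` feedback wires at its input, which is its composite with an identity, so the
right identity law finishes. -/
theorem ofProp_comp {a b c : ℕ} (f : A b c) (g : A a b) :
    ofProp P (P.comp f g) = P.compClass (ofProp P f) (ofProp P g) := by
  have h1 : P.compClass (ofProp P f) (ofProp P g) = P.loopClass (b + 0)
      (finCongr (by omega))
      (P.comp (P.tensor g (P.idn c))
        (P.conj (finAddFlip : Fin (b + a) ≃ Fin (a + b)) (P.tensor (P.idn a) f) (Equiv.refl _)))
      (finCongr (by omega)) := by
    rw [← comp_perm_eq, ← P.comp_assoc, ← tensor_eq_comp, comp_perm_eq, ofProp_eq_loopClass,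
      ofProp_eq_loopClass, compClass_loopClass, loopClass_conj]
    refine P.loopClass_eq (finCongr (by omega)) ?_ ?_
    all_goals
      ext i
      simp only [Equiv.trans_apply, Equiv.refl_apply, addPerm_val, finCongr_apply, Fin.val_cast,
        finAddFlip_val, compPerm_val, dite_eq_ite]
      grind
  have h2 : P.loopClass (a + 0) (finCongr (by omega))
      (P.comp (P.conj (finAddFlip : Fin (b + a) ≃ Fin (a + b)) (P.tensor (P.idn a) f)
        (Equiv.refl _)) (P.tensor g (P.idn a)))
      (finCongr (by omega)) = ofProp P (P.comp f g) := by
    have e : P.comp (P.conj (finAddFlip : Fin (b + a) ≃ Fin (a + b)) (P.tensor (P.idn a) f)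
        (Equiv.refl _)) (P.tensor g (P.idn a)) =
        P.conj finAddFlip (P.tensor (P.idn a) (P.comp f g)) (Equiv.refl _) := by
      have := P.tensor_swap g (P.idn a)
      rw [this, conj_comp_conj, finAddFlip_trans, conj_refl, ← idn_tensor_comp]
    rw [e, ← P.compClass_idn (ofProp P (P.comp f g)), ofProp_eq_loopClass, ofProp_eq_loopClass,
      compClass_loopClass, loopClass_conj]
    refine P.loopClass_eq (finCongr (by omega)) ?_ ?_
    all_goals
      ext i
      simp only [Equiv.trans_apply, Equiv.refl_apply, addPerm_val, finCongr_apply, Fin.val_cast,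
        finAddFlip_val, compPerm_val, dite_eq_ite]
      grind
  rw [h1, ← h2]
  refine (P.loopClass_slide g _ (x := 0) (finCongr (Nat.zero_add _))
    (finCongr (Nat.zero_add _).symm) (Equiv.refl _) (Equiv.refl _) ?_ ?_ ?_ ?_).symm
  all_goals
    ext i
    simp only [Equiv.trans_apply, Equiv.refl_apply, addPerm_val, finCongr_apply, Fin.val_cast,
      dite_eq_ite]
    grind

/-- The operations on classes. -/
def traceOps : PropOps (TraceHom P) where
  comp := P.compClass
  tensor := P.tensorClass
  empty := ofProp P P.empty
  wire := ofProp P P.wire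
  sigma := ofProp P P.sigma

theorem traceOps_idn (n : ℕ) : P.traceOps.idn n = ofProp P (P.idn n) := by
  induction n with
  | zero => rfl
  | succ n ih =>
    have h : P.traceOps.idn (n + 1) = P.tensorClass (P.traceOps.idn n) (ofProp P P.wire) := rfl
    rw [h, ih]
    exact (P.ofProp_tensor _ _).symm

theorem traceOps_sym (n : ℕ) : P.traceOps.sym n = ofProp P (P.sym n) := by
  induction n with
  | zero => rfl
  | succ n ih =>
    have h : P.traceOps.sym (n + 1) = P.compClass (m := n + 1 + 1)
      (P.tensorClass (m := n + 1) (n := 1 + n) (P.traceOps.sym n) (ofProp P P.wire))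
      (P.tensorClass (m := n) (n := n) (P.traceOps.idn n) (ofProp P P.sigma)) := rfl
    rw [h, ih, traceOps_idn, ← ofProp_tensor, ← ofProp_tensor]
    exact (P.ofProp_comp (b := n + 1 + 1) _ _).symm

/-- Both sides are written as composites, the second with an identity; they then differ by the
relabelling `e` of the connecting wires. -/
theorem perm_compClass {k n m m' a b : ℕ} (e : Fin m ≃ Fin m') (π : Fin (k + n) ≃ Fin a) (F : A a b)
    (ρ : Fin b ≃ Fin (k + m)) :
    P.compClass (ofProp P (P.perm e)) (P.loopClass k π F ρ) =
      P.loopClass k π F (ρ.trans (addPerm (Equiv.refl _) e)) := by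
  rw [← P.idn_compClass (P.loopClass k π F (ρ.trans _)), ofProp_eq_loopClass, ofProp_eq_loopClass,
    compClass_loopClass, compClass_loopClass, ← P.conj_refl (P.perm e), conj_perm,
    show (Equiv.refl _).trans (e.trans (Equiv.refl _)) = e.trans (Equiv.refl _) from rfl,
    ← conj_idn, tensor_conj, loopClass_conj]
  refine P.loopClass_eq (addPerm (addPerm (Equiv.refl _) e) (Equiv.refl _)) ?_ ?_
  all_goals
    ext i
    simp only [Equiv.trans_apply, Equiv.refl_apply, addPerm_val, finCongr_apply, Fin.val_cast,
      finAddFlip_val, compPerm_val, dite_eq_ite]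
    grind

theorem compClass_perm {k n n' m a b : ℕ} (e : Fin n' ≃ Fin n) (π : Fin (k + n) ≃ Fin a) (F : A a b)
    (ρ : Fin b ≃ Fin (k + m)) :
    P.compClass (P.loopClass k π F ρ) (ofProp P (P.perm e)) =
      P.loopClass k ((addPerm (Equiv.refl _) e).trans π) F ρ := by
  suffices h : ∀ G : A (k + n) (k + m),
      P.compClass (P.loopClass k (Equiv.refl _) G (Equiv.refl _)) (ofProp P (P.perm e)) =
        P.loopClass k (addPerm (Equiv.refl _) e) G (Equiv.refl _) by
    have := h (P.conj π F ρ)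
    rwa [loopClass_conj, loopClass_conj] at this
  intro G
  obtain rfl := Fin.equiv_iff_eq.1 ⟨e⟩
  rw [← P.compClass_idn (P.loopClass k (addPerm _ e) G _), ofProp_eq_loopClass,
    ofProp_eq_loopClass, compClass_loopClass, compClass_loopClass, ← P.conj_refl (P.perm e),
    conj_perm,
    show (Equiv.refl _).trans (e.trans (Equiv.refl _)) = (Equiv.refl _).trans e from rfl,
    ← conj_idn, conj_tensor, loopClass_conj]
  refine Eq.symm (P.loopClass_eq (addPerm (addPerm (Equiv.refl _) e) (Equiv.refl _)) ?_ ?_)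
  all_goals
    ext i
    simp only [Equiv.trans_apply, Equiv.refl_apply, addPerm_val, finCongr_apply, Fin.val_cast,
      finAddFlip_val, compPerm_val, dite_eq_ite]
    grind (splits := 30)

theorem sym_naturalClass {a b : ℕ} (f : TraceHom P a b) :
    P.compClass (ofProp P (P.sym b)) (P.tensorClass f (ofProp P P.wire)) =
      P.compClass (P.tensorClass (ofProp P P.wire) f) (ofProp P (P.sym a)) := by
  obtain ⟨p, M, rfl⟩ := P.exists_traceClass f
  rw [traceClass_eq_loopClass, sym_eq_perm, sym_eq_perm, ofProp_eq_loopClass P P.wire,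
    tensorClass_loopClass, tensorClass_loopClass, perm_compClass, compClass_perm,
    tensor_wire_eq_conj, loopClass_conj]
  refine P.loopClass_eq (finCongr (by omega)) ?_ ?_
  all_goals
    ext i
    simp only [Equiv.trans_apply, Equiv.refl_apply, addPerm_val, finCongr_apply, Fin.val_cast,
      finAddFlip_val, midSwap_val, dite_eq_ite]
    grind

theorem tightening_left {a b c : ℕ} (g : TraceHom P b c) (f : TraceHom P (1 + a) (1 + b)) :
    P.traceOp (P.compClass (P.tensorClass (ofProp P P.wire) g) f) =
      P.compClass g (P.traceOp f) := by
  obtain ⟨p, G, rfl⟩ := P.exists_traceClass g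
  obtain ⟨q, F, rfl⟩ := P.exists_traceClass f
  rw [traceClass_eq_loopClass, traceClass_eq_loopClass, ofProp_eq_loopClass P P.wire,
    tensorClass_loopClass, compClass_loopClass, traceOp_loopClass, traceOp_loopClass,
    compClass_loopClass]
  -- The extra identity wire on the other side lies on the output of `F` to be traced, which is
  -- output `q` of `F ⊗ G`. The relabelling sends the new feedback wire to the connection at `q`,
  -- and the old traced wire to the outer trace in last place.
  refine Eq.symm ((P.loopClass_addWire _ _ _ ⟨q, by omega⟩).trans ?_)
  rw [P.tensor_left_swap F, loopClass_conj]
  refine P.loopClass_eq (natEquiv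
    (fun i => if i = 0 then q else if i = q + 1 then q + 1 + b + p else i - 1)
    (fun i => if i = q then 0 else if i = q + 1 + b + p then q + 1 else i + 1)
    (by grind) (by grind)) ?_ ?_
  all_goals
    ext i
    simp only [Equiv.trans_apply, Equiv.refl_apply, addPerm_val, finCongr_apply, Fin.val_cast,
      midSwap_val, natEquiv_val, leftSwap_val, compPerm_val, headSwap_val, dite_eq_ite]
    grind (splits := 30)

theorem tightening_right {a b c : ℕ} (f : TraceHom P (1 + b) (1 + c)) (h : TraceHom P a b) :
    P.traceOp (P.compClass f (P.tensorClass (ofProp P P.wire) h)) =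
      P.compClass (P.traceOp f) h := by
  obtain ⟨p, F, rfl⟩ := P.exists_traceClass f
  obtain ⟨q, H, rfl⟩ := P.exists_traceClass h
  rw [traceClass_eq_loopClass, traceClass_eq_loopClass, ofProp_eq_loopClass P P.wire,
    tensorClass_loopClass, compClass_loopClass, traceOp_loopClass, traceOp_loopClass,
    compClass_loopClass]
  -- Here the box `H` precedes `F`, so the traced output of `F` has position `(q + b) + p`. The new
  -- feedback wire becomes the outer trace and the old one the connection at `q`.
  refine Eq.symm ((P.loopClass_addWire _ _ _ ⟨q + b + p, by omega⟩).trans ?_)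
  rw [tensor_tensor_eq_conj, loopClass_conj]
  refine P.loopClass_eq (natEquiv
    (fun i => if i = 0 then q + 1 + b + p else if i < q + 1 then i - 1 else
      if i = q + 1 + b + p then q else i)
    (fun i => if i = q then q + 1 + b + p else if i < q then i + 1 else
      if i = q + 1 + b + p then 0 else i)
    (by grind) (by grind)) ?_ ?_
  all_goals
    ext i
    simp only [Equiv.trans_apply, Equiv.refl_apply, addPerm_val, finCongr_apply, Fin.val_cast,
      midSwap_val, natEquiv_val, leftSwap_val, compPerm_val, headSwap_val, dite_eq_ite]
    grind (splits := 30)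

theorem strengthClass {a b c d : ℕ} (f : TraceHom P (1 + a) (1 + b)) (g : TraceHom P c d) :
    P.traceOp (castHom (Nat.add_assoc 1 a c) (Nat.add_assoc 1 b d) (P.tensorClass f g)) =
      P.tensorClass (P.traceOp f) g := by
  obtain ⟨p, F, rfl⟩ := P.exists_traceClass f
  obtain ⟨q, G, rfl⟩ := P.exists_traceClass g
  rw [traceClass_eq_loopClass, traceClass_eq_loopClass, tensorClass_loopClass, castHom_loopClass,
    traceOp_loopClass, traceOp_loopClass, tensorClass_loopClass]
  refine P.loopClass_eq ((finCongr (Nat.add_assoc _ _ _)).trans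
    ((addPerm (Equiv.refl (Fin p)) finAddFlip).trans (finCongr (Nat.add_assoc _ _ _).symm))) ?_ ?_
  all_goals
    ext i
    simp only [Equiv.trans_apply, Equiv.refl_apply, addPerm_val, finCongr_apply, Fin.val_cast,
      midSwap_val, finAddFlip_val, dite_eq_ite]
    grind

/-- The symmetry is what the wire-adding rule makes of a single identity wire. -/
theorem yankingClass : P.traceOp (m := 1) (n := 1) (ofProp P P.sigma) = ofProp P P.wire := by
  have h : P.sigma = P.conj (Equiv.refl _) (P.tensor P.wire P.wire)
      (headSwap (b := 2) 0 Nat.one_pos rfl) := by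
    have h1 : P.tensor P.wire P.wire = P.idn (1 + 1) := by rw [← idn_one, idn_tensor_idn]
    have h2 : headSwap (b := 2) 0 Nat.one_pos rfl = swapTwo := by
      ext i
      fin_cases i <;> rfl
    rw [h1, conj_idn, ← perm_swapTwo, h2]
    rfl
  rw [ofProp_eq_loopClass P P.wire, P.loopClass_addWire _ _ _ ⟨0, by omega⟩, ofProp_eq_loopClass, h,
    loopClass_conj]
  refine (P.traceOp_loopClass (m := 1) (n := 1) _ _ _).trans ?_
  refine P.loopClass_eq (Equiv.refl _) ?_ ?_
  all_goals
    ext i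
    simp only [Equiv.trans_apply, Equiv.refl_apply, addPerm_val, finCongr_apply, Fin.val_cast,
      headSwap_val, dite_eq_ite]
    grind

theorem iterTrace_loopClass {a b k p m n : ℕ} (π : Fin (k + (p + m)) ≃ Fin a) (M : A a b)
    (ρ : Fin b ≃ Fin (k + (p + n))) :
    iterTrace P.traceOp p (P.loopClass k π M ρ) = P.loopClass (k + p)
      ((finCongr (Nat.add_assoc k p m)).trans π) M
      (ρ.trans (finCongr (Nat.add_assoc k p n).symm)) := by
  induction p generalizing k with
  | zero =>
    rw [iterTrace, castHom_loopClass]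
    rfl
  | succ p ih =>
    rw [iterTrace, castHom_loopClass, traceOp_loopClass, ih]
    refine P.loopClass_eq (finCongr (by omega)) ?_ ?_
    all_goals
      rw [addPerm_finCongr]
      ext i
      simp

/-- The permutation of the sources in the graph shared by the two sides of the sliding axiom. -/
def slidePerm (k l m n p : ℕ) : Fin (l + m + k + n + p) ≃ Fin (l + n + (k + (m + p))) :=
  natEquiv
    (fun i => if i < l then i else if i < l + m then i + n + k else if i < l + m + k then i - m + n
      else if i < l + m + k + n then i - m - k else i)
    (fun i => if i < l then i else if i < l + n then i + m + k else if i < l + n + k then i - n + m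
      else if i < l + n + k + m then i - n - k else i) (by grind) (by grind)

theorem slidePerm_val {k l m n p : ℕ} (i : Fin (l + m + k + n + p)) :
    (slidePerm k l m n p i : ℕ) = if (i : ℕ) < l then (i : ℕ) else
      if (i : ℕ) < l + m then i + n + k else if (i : ℕ) < l + m + k then i - m + n else
      if (i : ℕ) < l + m + k + n then i - m - k else i := rfl

theorem slidingClass {m n p q : ℕ} (f : TraceHom P (m + p) (n + q)) (g : TraceHom P n m) :
    iterTrace P.traceOp n (P.compClass f (P.tensorClass g (ofProp P (P.idn p)))) =
      iterTrace P.traceOp m (P.compClass (P.tensorClass g (ofProp P (P.idn q))) f) := by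
  obtain ⟨k, F, rfl⟩ := P.exists_traceClass f
  obtain ⟨l, G, rfl⟩ := P.exists_traceClass g
  rw [traceClass_eq_loopClass, traceClass_eq_loopClass]
  -- The common diagram joins `G` and `F` in a cycle: feedback of `G`, wires from `G` to `F`,
  -- feedback of `F`, wires from `F` to `G`. Each side contains in addition the identity wires of
  -- `id_p` or `id_q`, supplied by the right or left identity law.
  trans P.loopClass (l + m + k + n) (slidePerm k l m n p) (P.tensor G F)
    (finCongr (by omega : l + m + (k + (n + q)) = l + m + k + n + q))
  · rw [← P.compClass_idn (P.loopClass (l + m + k + n) (slidePerm k l m n p) _ _),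
      ofProp_eq_loopClass, compClass_loopClass, tensorClass_loopClass, compClass_loopClass,
      iterTrace_loopClass,
      tensor_tensor_eq_conj, P.tensor_left_swap G, conj_conj, loopClass_conj]
    refine P.loopClass_eq ((finCongr (by omega)).trans ((leftSwap (l + m) p (k + n)).trans
      (finCongr (by omega)))) ?_ ?_
    all_goals
      ext i
      simp only [Equiv.trans_apply, Equiv.refl_apply, addPerm_val, finCongr_apply, Fin.val_cast,
        midSwap_val, slidePerm_val, leftSwap_val, compPerm_val, dite_eq_ite]
      grind (splits := 30)
  · rw [← P.idn_compClass (P.loopClass (l + m + k + n) (slidePerm k l m n p) _ _),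
      ofProp_eq_loopClass, compClass_loopClass, tensorClass_loopClass, compClass_loopClass,
      iterTrace_loopClass,
      P.tensor_left_swap F G, tensor_tensor_eq_conj, loopClass_conj, loopClass_conj]
    refine P.loopClass_eq ((finCongr (by omega)).trans
      ((finAddFlip : Fin (l + m + (k + n + q)) ≃ Fin (k + n + q + (l + m))).trans
      (finCongr (by omega)))) ?_ ?_
    all_goals
      ext i
      simp only [Equiv.trans_apply, Equiv.refl_apply, addPerm_val, finCongr_apply, Fin.val_cast,
        midSwap_val, slidePerm_val, leftSwap_val, compPerm_val, finAddFlip_val, dite_eq_ite]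
      grind (splits := 30)

/-- The explicit traced prop. -/
def traceProp : TracedPropStr (TraceHom P) where
  toPropOps := P.traceOps
  comp_assoc := P.compClass_assoc
  tensor_assoc := P.tensorClass_assoc
  interchange := P.interchangeClass
  tensor_empty := P.tensorClass_empty
  empty_tensor := P.empty_tensorClass
  comp_idn f := by rw [traceOps_idn]; exact P.compClass_idn f
  idn_comp f := by rw [traceOps_idn]; exact P.idn_compClass f
  sigma_sigma := by
    rw [traceOps_idn, ← P.sigma_sigma]
    exact (P.ofProp_comp _ _).symm
  sym_natural f := by rw [traceOps_sym, traceOps_sym]; exact P.sym_naturalClass f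
  trace := P.traceOp
  tightening g f h := by
    refine (P.tightening_right _ _).trans ?_
    exact congrArg (P.compClass · h) (P.tightening_left g f)
  yanking := P.yankingClass
  sliding f g := by
    rw [traceOps_idn, traceOps_idn]
    exact P.slidingClass f g
  strength := P.strengthClass

/-- The prop functor `M ↦ [M, 0]`. -/
def toTraceProp : PropFunctor P P.traceProp.toPropStr where
  map := ofProp P
  map_comp := P.ofProp_comp
  map_tensor := P.ofProp_tensor
  map_wire := rfl
  map_empty := rfl
  map_sigma := rfl

end PropStr

/-! ### Iterated traces -/

section IterTrace

variable {Hom : ℕ → ℕ → Type u} (tr : {m n : ℕ} → Hom (1 + m) (1 + n) → Hom m n)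

theorem trace_castHom {m n m' n' : ℕ} (hm : m = m') (hn : n = n') (f : Hom (1 + m) (1 + n)) :
    tr (castHom (congrArg (1 + ·) hm) (congrArg (1 + ·) hn) f) = castHom hm hn (tr f) := by
  subst hm hn; rfl

theorem iterTrace_castHom {p m n m' n' : ℕ} (hm : m = m') (hn : n = n')
    (f : Hom (p + m) (p + n)) :
    iterTrace tr p (castHom (congrArg (p + ·) hm) (congrArg (p + ·) hn) f) =
      castHom hm hn (iterTrace tr p f) := by
  subst hm hn; rfl

/-- The iteration removes the first wire first; this makes it possible to peel off the last removed
wire instead, as `iterTrace_succ` and `iterTrace_add` require. -/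
theorem iterTrace_trace {p m n : ℕ} (f : Hom (1 + (p + m)) (1 + (p + n))) :
    iterTrace tr p (tr f) =
      tr (iterTrace tr p (castHom (Nat.add_left_comm _ _ _) (Nat.add_left_comm _ _ _) f)) := by
  induction p with
  | zero =>
    rw [iterTrace, iterTrace, castHom_castHom]
    exact (trace_castHom tr (Nat.zero_add m) (Nat.zero_add n) f).symm
  | succ p ih =>
    rw [iterTrace, iterTrace, castHom_castHom,
      ← trace_castHom tr (by omega : p + 1 + m = 1 + (p + m)) (by omega : p + 1 + n = 1 + (p + n)),
      ih, ← trace_castHom tr (by omega : 1 + (p + m) = p + (1 + m))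
        (by omega : 1 + (p + n) = p + (1 + n)), castHom_castHom]

theorem iterTrace_succ {p m n : ℕ} (f : Hom (p + 1 + m) (p + 1 + n)) :
    iterTrace tr (p + 1) f =
      tr (iterTrace tr p (castHom (Nat.add_assoc _ _ _) (Nat.add_assoc _ _ _) f)) := by
  rw [iterTrace, iterTrace_trace, castHom_castHom]

theorem iterTrace_add {p q m n : ℕ} (f : Hom (p + q + m) (p + q + n)) :
    iterTrace tr (p + q) f =
      iterTrace tr q (iterTrace tr p (castHom (Nat.add_assoc _ _ _) (Nat.add_assoc _ _ _) f)) := by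
  induction q generalizing m n with
  | zero =>
    rw [iterTrace, ← iterTrace_castHom, castHom_castHom]
    rfl
  | succ q ih =>
    refine (iterTrace_succ tr (p := p + q) f).trans ?_
    rw [ih, iterTrace_succ, ← iterTrace_castHom, castHom_castHom, castHom_castHom]

end IterTrace

/-! ### Evaluating the representatives in a traced prop -/

namespace TracedPropStr

variable {C : ℕ → ℕ → Type u} (S : TracedPropStr C)

open PropStr

theorem castHom_comp {a b c a' b' c' : ℕ} (ha : a = a') (hb : b = b') (hc : c = c') (f : C b c)
    (g : C a b) : castHom ha hc (S.comp f g) = S.comp (castHom hb hc f) (castHom ha hb g) := by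
  subst ha hb hc; rfl

theorem castHom_idn_succ_tensor {a b : ℕ} (p : ℕ) (f : C a b) :
    castHom (by omega : p + 1 + a = 1 + (p + a)) (by omega : p + 1 + b = 1 + (p + b))
      (S.tensor (S.idn (p + 1)) f) = S.tensor S.wire (S.tensor (S.idn p) f) := by
  have h : S.idn (p + 1) = S.conj finAddFlip (S.tensor S.wire (S.idn p)) finAddFlip :=
    tensor_swap S.toPropStr (S.idn p) S.wire
  have h' : S.tensor S.wire (S.idn p) = S.idn (1 + p) := by
    rw [← idn_one S.toPropStr, idn_tensor_idn]
  rw [castHom_eq_conj S.toPropStr, h, conj_tensor, h', tensor_tensor_eq_conj' _ S.wire, h',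
    conj_conj]
  have e : S.idn (1 + p) = S.conj (Equiv.refl _) (S.idn (1 + p)) (Equiv.refl _) :=
    (conj_refl _ _).symm
  -- Conjugating an identity by inverse bijections gives an identity, so the block exchange may be
  -- replaced by a cast.
  have e' : S.conj (finAddFlip : Fin (p + 1) ≃ Fin (1 + p)) (S.idn (1 + p)) finAddFlip =
      S.conj (finCongr (Nat.add_comm p 1)) (S.idn (1 + p)) (finCongr (Nat.add_comm 1 p)) := by
    rw [conj_idn, conj_idn, finAddFlip_trans]
    congr 1
  rw [← conj_conj, ← conj_tensor, e', conj_tensor, conj_conj]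
  refine conj_congr _ ?_ rfl ?_
  all_goals
    ext i
    simp
    try grind

theorem iterTrace_tightening {a b c d : ℕ} (p : ℕ) (g : C c d) (f : C (p + b) (p + c))
    (h : C a b) :
    iterTrace S.trace p (S.comp (S.comp (S.tensor (S.idn p) g) f) (S.tensor (S.idn p) h)) =
      S.comp (S.comp g (iterTrace S.trace p f)) h := by
  induction p with
  | zero =>
    rw [iterTrace, castHom_comp S _ (Nat.zero_add b), castHom_comp S _ (Nat.zero_add c)]
    exact congrArg₂ _ (congrArg₂ _ (S.empty_tensor g) rfl) (S.empty_tensor h)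
  | succ p ih =>
    rw [iterTrace, castHom_comp S _ (by omega : p + 1 + b = 1 + (p + b)),
      castHom_comp S _ (by omega : p + 1 + c = 1 + (p + c)), castHom_idn_succ_tensor,
      castHom_idn_succ_tensor, S.tightening, ih, iterTrace]

theorem castHom_tensor {a b c d a' b' : ℕ} (ha : a = a') (hb : b = b') (f : C a b) (g : C c d) :
    castHom (congrArg (· + c) ha) (congrArg (· + d) hb) (S.tensor f g) =
      S.tensor (castHom ha hb f) g := by
  subst ha hb; rfl

theorem iterTrace_strength {a b c d : ℕ} (p : ℕ) (f : C (p + a) (p + b)) (g : C c d) :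
    iterTrace S.trace p (castHom (Nat.add_assoc p a c) (Nat.add_assoc p b d) (S.tensor f g)) =
      S.tensor (iterTrace S.trace p f) g := by
  induction p with
  | zero =>
    rw [iterTrace, castHom_castHom, iterTrace]
    exact S.castHom_tensor (Nat.zero_add a) (Nat.zero_add b) f g
  | succ p ih =>
    have h := S.castHom_tensor (by omega : p + 1 + a = 1 + (p + a))
      (by omega : p + 1 + b = 1 + (p + b)) f g
    rw [iterTrace, iterTrace, ← ih, ← S.strength, ← h, castHom_castHom, castHom_castHom,
      ← trace_castHom (Hom := C) S.trace (Nat.add_assoc p a c) (Nat.add_assoc p b d),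
      castHom_castHom]

theorem iterTrace_conj_tensor {p m n c d r s : ℕ} (M : C (p + m) (p + n)) (X : C c d)
    (π : Fin r ≃ Fin (m + c)) (ρ : Fin (n + d) ≃ Fin s) {π' : Fin (p + r) ≃ Fin (p + m + c)}
    {ρ' : Fin (p + n + d) ≃ Fin (p + s)}
    (hπ : π' = (addPerm (Equiv.refl _) π).trans (finCongr (Nat.add_assoc _ _ _).symm))
    (hρ : ρ' = (finCongr (Nat.add_assoc _ _ _)).trans (addPerm (Equiv.refl _) ρ)) :
    iterTrace S.trace p (S.conj π' (S.tensor M X) ρ') =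
      S.conj π (S.tensor (iterTrace S.trace p M) X) ρ := by
  have h := S.iterTrace_tightening p (S.perm ρ)
    (castHom (Nat.add_assoc _ _ _) (Nat.add_assoc _ _ _) (S.tensor M X)) (S.perm π)
  rw [iterTrace_strength, castHom_eq_conj S.toPropStr, ← perm_refl, perm_tensor, perm_tensor,
    perm_comp_conj, conj_comp_perm] at h
  rw [hπ, hρ, h, conj, S.comp_assoc]

/-- Conjugation by the exchange `e` of `0` and `x` on the untraced wires reduces to `σ ⊗ id`;
tightening removes `e`, strength removes the identity, and yanking does the rest. -/
theorem trace_headSwap {b : ℕ} (x : ℕ) (hx : x < b) :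
    S.trace (S.perm (headSwap x hx rfl)) = S.idn b := by
  obtain ⟨b, rfl⟩ : ∃ k, b = 1 + k := ⟨b - 1, by omega⟩
  let e : Fin (1 + b) ≃ Fin (1 + b) := natEquiv
    (fun i => if i = x then 0 else if i = 0 then x else i)
    (fun i => if i = x then 0 else if i = 0 then x else i) (by grind) (by grind)
  have he (i) : (e i : ℕ) = if (i : ℕ) = x then 0 else if (i : ℕ) = 0 then x else i := rfl
  have hs : (finAddFlip : Fin (1 + 1) ≃ Fin (1 + 1)) = headSwap (a := 1) 0 Nat.one_pos rfl := by
    ext i; fin_cases i <;> rfl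
  have h : S.perm (headSwap x hx rfl) = S.comp (S.comp (S.tensor S.wire (S.perm e))
      (castHom (Nat.add_assoc 1 1 b) (Nat.add_assoc 1 1 b) (S.tensor S.sigma (S.idn b))))
      (S.tensor S.wire (S.perm e)) := by
    rw [← idn_one S.toPropStr, ← perm_refl, ← perm_refl, perm_tensor, ← perm_sigma S.toPropStr, hs]
    refine Eq.symm ((congrArg (fun t => S.comp (S.comp _ (castHom _ _ t)) _)
      (perm_tensor S.toPropStr _ _)).trans ?_)
    rw [castHom_perm, perm_comp, perm_comp]
    congr 1
    ext i
    simp only [Equiv.trans_apply, Equiv.refl_apply, addPerm_val, finCongr_apply, Fin.val_cast, he,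
      headSwap_val, dite_eq_ite]
    grind (splits := 30)
  have hw : S.tensor S.wire (S.idn b) = S.idn (1 + b) := by
    rw [← idn_one S.toPropStr, idn_tensor_idn]
  have hee : e.trans e = Equiv.refl _ := by
    ext i
    simp [he]
    grind
  rw [h, S.tightening]
  refine (congrArg (fun t => S.comp (S.comp _ t) _) (S.strength (a := 1) (b := 1) _ _)).trans ?_
  rw [S.yanking, hw, S.comp_idn, perm_comp, hee, perm_refl]

theorem trace_headSwap_comp {a b : ℕ} (x : ℕ) (hx : x < b) (M : C a b) :
    S.trace (S.comp (S.perm (headSwap x hx rfl)) (S.tensor S.wire M)) = M := by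
  have h := S.tightening (S.idn b) (S.perm (headSwap x hx rfl)) M
  have hw : S.tensor S.wire (S.idn b) = S.idn (1 + b) := by
    rw [← idn_one S.toPropStr, idn_tensor_idn]
  rwa [hw, S.idn_comp, trace_headSwap, S.idn_comp, S.idn_comp] at h

theorem iterTrace_headBlockSwap {b : ℕ} (c j : ℕ) (hj : j + c ≤ b) :
    iterTrace S.trace c (S.perm (headBlockSwap c j hj)) = S.idn b := by
  induction c generalizing j with
  | zero =>
    rw [iterTrace, castHom_perm, ← perm_refl]
    congr 1
    ext i
    simp
  | succ c ih =>
    rw [iterTrace, ← ih (j + 1) (by omega)]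
    congr 1
    rw [← S.trace_headSwap_comp (c + j) (by omega : c + j < c + b) (S.perm (headBlockSwap c _ _)),
      castHom_perm, ← idn_one S.toPropStr, ← perm_refl, perm_tensor, perm_comp]
    congr 2
    ext i
    simp
    grind

/-- Tracing the `q` wires replaces `N` by its trace `N'`. Sliding `N'` along the `m` connecting
wires places it before `M`, leaving `r` straight loops that yank to the identity; the last `p`
traces then fall on `M`. -/
theorem iterTrace_compRep {p q r m n : ℕ} (M : C (p + m) (p + n)) (N : C (q + r) (q + m)) :
    iterTrace S.trace (q + m + p) (compRep S.toPropStr M N) =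
      S.comp (iterTrace S.trace p M) (iterTrace S.trace q N) := by
  let β : Fin (m + (p + r)) ≃ Fin (r + (p + m)) :=
    ((finCongr (Nat.add_assoc _ _ _).symm).trans (blockFlip m p r)).trans
      (finCongr (Nat.add_assoc _ _ _))
  rw [compRep_eq_conj, iterTrace_add, iterTrace_add, castHom_castHom,
    castHom_eq_conj S.toPropStr, conj_conj, S.iterTrace_conj_tensor N M β (Equiv.refl _)]
  rotate_left
  · ext i
    simp [β]
    grind
  · ext i
    simp
    grind
  generalize iterTrace S.trace q N = N'
  have h1 : S.conj β (S.tensor N' M) (Equiv.refl _) = S.comp (S.tensor N' (S.idn (p + n)))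
      (S.comp (S.tensor (S.idn r) M) (S.perm β)) := by
    rw [← comp_perm_eq, tensor_eq_comp, S.comp_assoc]
  have h2 : S.comp (S.comp (S.tensor (S.idn r) M) (S.perm β)) (S.tensor N' (S.idn (p + r))) =
      S.comp (S.comp (S.tensor (S.idn r) (S.comp M (S.tensor (S.idn p) N')))
        (S.perm (headBlockSwap r p le_rfl))) (S.tensor (S.idn r) (S.idn (p + r))) := by
    have e : S.idn (p + r) = S.conj finAddFlip (S.tensor (S.idn r) (S.idn p)) finAddFlip := by
      rw [idn_tensor_idn, conj_idn, finAddFlip_trans, perm_refl]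
    rw [idn_tensor_comp, S.comp_assoc, S.comp_assoc, S.comp_assoc]
    congr 1
    rw [idn_tensor_idn, S.comp_idn, e, tensor_conj, tensor_swap, tensor_tensor_eq_conj, conj_conj,
      conj_conj, perm_comp_conj, comp_perm_eq]
    refine conj_congr _ ?_ rfl ?_
    all_goals
      ext i
      simp [β]
      grind
  rw [h1, ← S.sliding, h2, iterTrace_tightening, iterTrace_headBlockSwap, S.comp_idn, S.comp_idn]
  have h3 := S.iterTrace_tightening p (S.idn n) M N'
  rwa [idn_tensor_idn, S.idn_comp, S.idn_comp] at h3

theorem iterTrace_tensorRep {p q m n m' n' : ℕ} (M : C (p + m) (p + n))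
    (N : C (q + m') (q + n')) :
    iterTrace S.trace (p + q) (tensorRep S.toPropStr M N) =
      S.tensor (iterTrace S.trace p M) (iterTrace S.trace q N) := by
  rw [tensorRep_eq_conj, iterTrace_add, castHom_eq_conj S.toPropStr, conj_conj,
    S.iterTrace_conj_tensor M N (leftSwap q m m') (leftSwap n q n')]
  rotate_left
  · ext i
    simp
    grind
  · ext i
    simp
    grind
  rw [S.tensor_swap _ N, conj_conj, S.iterTrace_conj_tensor N _ finAddFlip finAddFlip,
    ← tensor_swap]
  all_goals
    ext i
    simp
    grind

/-- The added wire comes first, so it is traced first, and `trace_headSwap_comp` yanks it straight.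
-/
theorem iterTrace_addWire {k n m : ℕ} (j r : ℕ) (h : k + m = j + 1 + r) (M : C (k + n) (k + m)) :
    iterTrace S.trace (k + 1) (addWire S.toPropStr j r h M) = iterTrace S.trace k M := by
  rw [addWire_eq_conj, iterTrace, castHom_eq_conj S.toPropStr, conj_conj]
  conv_rhs => rw [← S.trace_headSwap_comp j (by omega : j < k + m) M]
  congr 2
  rw [perm_comp_eq]
  refine conj_congr _ ?_ rfl ?_
  all_goals
    ext i
    simp

end TracedPropStr

/-! ### Prop functors preserve the constructions -/

namespace PropFunctor

variable {A : ℕ → ℕ → Type u} {B : ℕ → ℕ → Type v} {P : PropStr A} {Q : PropStr B}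
  (η : PropFunctor P Q)

theorem map_castHom {a b a' b' : ℕ} (ha : a = a') (hb : b = b') (f : A a b) :
    η.map (castHom ha hb f) = castHom ha hb (η.map f) := by
  subst ha hb; rfl

theorem map_idn (n : ℕ) : η.map (P.idn n) = Q.idn n := by
  induction n with
  | zero => exact η.map_empty
  | succ n ih => exact (η.map_tensor _ _).trans (by rw [ih, η.map_wire]; rfl)

theorem map_sym (n : ℕ) : η.map (P.sym n) = Q.sym n := by
  induction n with
  | zero => exact η.map_wire
  | succ n ih =>
    refine (η.map_comp (b := n + 1 + 1) _ _).trans ?_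
    rw [η.map_tensor (a := n + 1) (b := 1 + n), η.map_tensor (a := n) (b := n), ih, map_idn,
      η.map_wire, η.map_sigma]
    rfl

theorem map_symm (a b : ℕ) : η.map (P.symm a b) = Q.symm a b := by
  induction b with
  | zero => exact (η.map_castHom _ _ _).trans (congrArg (castHom _ _) (η.map_idn a))
  | succ b ih =>
    refine (η.map_castHom _ _ _).trans ?_
    rw [η.map_comp (b := b + (a + 1)), η.map_tensor (a := b) (b := b),
      η.map_tensor (a := a + b) (b := b + a), ih, map_idn, map_sym, η.map_wire]
    rfl

theorem map_blockSwap (a b c : ℕ) : η.map (P.blockSwap a b c) = Q.blockSwap a b c := by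
  simp only [PropOps.blockSwap, η.map_comp, map_castHom, η.map_tensor, map_symm, map_idn]

theorem map_compRep {p q r m n : ℕ} (M : A (p + m) (p + n)) (N : A (q + r) (q + m)) :
    η.map (compRep P M N) = compRep Q (η.map M) (η.map N) := by
  simp only [compRep, η.map_comp, map_castHom, η.map_tensor, map_idn, map_blockSwap]

theorem map_tensorRep {p q m n m' n' : ℕ} (M : A (p + m) (p + n)) (N : A (q + m') (q + n')) :
    η.map (tensorRep P M N) = tensorRep Q (η.map M) (η.map N) := by
  simp only [tensorRep, η.map_comp, map_castHom, η.map_tensor, map_idn, map_symm]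

theorem map_addWire {k n m : ℕ} (j r : ℕ) (h : k + m = j + 1 + r) (M : A (k + n) (k + m)) :
    η.map (addWire P j r h M) = addWire Q j r h (η.map M) := by
  simp only [addWire, η.map_comp, map_castHom, η.map_tensor, map_idn, map_blockSwap, η.map_wire]

end PropFunctor

/-! ### Traced prop functors -/

namespace TracedPropFunctor

variable {A : ℕ → ℕ → Type u} {B : ℕ → ℕ → Type v} {P : TracedPropStr A} {Q : TracedPropStr B}

theorem eq_of_map_eq (F G : TracedPropFunctor P Q)
    (h : ∀ (a b : ℕ) (f : A a b), F.map f = G.map f) :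
    F = G := by
  obtain ⟨⟨F, _, _, _, _, _⟩, _⟩ := F
  obtain ⟨⟨G, _, _, _, _, _⟩, _⟩ := G
  obtain rfl : @F = @G := by
    funext a b f
    exact h a b f
  rfl

theorem map_iterTrace (F : TracedPropFunctor P Q) {p m n : ℕ} (f : A (p + m) (p + n)) :
    F.map (iterTrace P.trace p f) = iterTrace Q.trace p (F.map f) := by
  induction p with
  | zero => exact F.map_castHom _ _ _
  | succ p ih => rw [iterTrace, iterTrace, ih, F.map_trace, F.map_castHom]

/-- The identity functor. -/
def refl (P : TracedPropStr A) : TracedPropFunctor P P where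
  map f := f
  map_comp _ _ := rfl
  map_tensor _ _ := rfl
  map_wire := rfl
  map_empty := rfl
  map_sigma := rfl
  map_trace _ := rfl

/-- The composite of two functors. -/
def trans {C : ℕ → ℕ → Type w} {R : TracedPropStr C} (F : TracedPropFunctor P Q)
    (G : TracedPropFunctor Q R) : TracedPropFunctor P R where
  map f := G.map (F.map f)
  map_comp _ _ := by rw [F.map_comp, G.map_comp]
  map_tensor _ _ := by rw [F.map_tensor, G.map_tensor]
  map_wire := by rw [F.map_wire, G.map_wire]
  map_empty := by rw [F.map_empty, G.map_empty]
  map_sigma := by rw [F.map_sigma, G.map_sigma]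
  map_trace _ := by rw [F.map_trace, G.map_trace]

end TracedPropFunctor

/-! ### The universal property -/

section Universal

variable {A : ℕ → ℕ → Type u} {P : PropStr A}

/-- The quotient is thus generated by the image of `P` under traces, which forces uniqueness of
extensions. -/
theorem traceClass_eq_iterTrace {k n m : ℕ} (M : A (k + n) (k + m)) :
    traceClass P k M = iterTrace P.traceProp.trace k (ofProp P M) := by
  rw [P.ofProp_eq_loopClass]
  refine Eq.trans ?_ (P.iterTrace_loopClass _ _ _).symm
  rw [P.traceClass_eq_loopClass]
  refine P.loopClass_eq (finCongr (Nat.zero_add k).symm) ?_ ?_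
  all_goals
    rw [addPerm_finCongr]
    ext i
    simp

variable {C : ℕ → ℕ → Type w} {S : TracedPropStr C} (η : PropFunctor P S.toPropStr)

/-- The map on classes induced by a prop functor to a traced prop. -/
def liftMap {n m : ℕ} (f : TraceHom P n m) : C n m :=
  Quot.lift (fun M => iterTrace S.trace M.1 (η.map M.2))
    (by
      rintro _ _ (⟨p, q, M, g⟩ | ⟨k, j, r, h, M⟩)
      · dsimp only
        rw [η.map_comp, η.map_comp, η.map_tensor, η.map_tensor, η.map_idn, η.map_idn]
        exact (S.sliding (η.map M) (η.map g)).symm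
      · dsimp only
        rw [η.map_addWire, S.iterTrace_addWire]) f

theorem liftMap_ofProp {n m : ℕ} (f : A n m) : liftMap η (ofProp P f) = η.map f := by
  change iterTrace S.trace 0 (η.map (castHom (Nat.zero_add n).symm (Nat.zero_add m).symm f)) = _
  rw [η.map_castHom, iterTrace, castHom_castHom, castHom_self]

/-- The traced prop functor induced by a prop functor to a traced prop. -/
def liftFunctor : TracedPropFunctor P.traceProp S where
  map := liftMap η
  map_comp f g := by
    obtain ⟨⟨p, M⟩, rfl⟩ := Quot.exists_rep f
    obtain ⟨⟨q, N⟩, rfl⟩ := Quot.exists_rep g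
    change iterTrace S.trace _ (η.map (compRep P M N)) = _
    rw [η.map_compRep, S.iterTrace_compRep]
    rfl
  map_tensor f g := by
    obtain ⟨⟨p, M⟩, rfl⟩ := Quot.exists_rep f
    obtain ⟨⟨q, N⟩, rfl⟩ := Quot.exists_rep g
    change iterTrace S.trace _ (η.map (tensorRep P M N)) = _
    rw [η.map_tensorRep, S.iterTrace_tensorRep]
    rfl
  map_wire := (liftMap_ofProp η _).trans η.map_wire
  map_empty := (liftMap_ofProp η _).trans η.map_empty
  map_sigma := (liftMap_ofProp η _).trans η.map_sigma
  map_trace f := by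
    obtain ⟨⟨p, M⟩, rfl⟩ := Quot.exists_rep f
    change iterTrace S.trace (p + 1) (η.map (castHom (Nat.add_assoc p 1 _).symm
      (Nat.add_assoc p 1 _).symm M)) = S.trace (iterTrace S.trace p (η.map M))
    rw [iterTrace_succ, η.map_castHom, castHom_castHom, castHom_self]

theorem isTracedCompletion_traceProp (P : PropStr A) :
    IsTracedCompletion.{u, u, w} P P.traceProp P.toTraceProp := by
  intro C S η
  refine ⟨liftFunctor η, fun a b f => liftMap_ofProp η f, fun G hG => ?_⟩
  refine TracedPropFunctor.eq_of_map_eq _ _ fun a b f => ?_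
  obtain ⟨k, M, rfl⟩ := P.exists_traceClass f
  rw [traceClass_eq_iterTrace, G.map_iterTrace, TracedPropFunctor.map_iterTrace]
  congr 1
  exact (hG _ _ M).trans (liftMap_ofProp η M).symm

/-- Each completion is tested against the other, so both universal properties are taken in the
universe where both live. The round trips agree with the identities because both extend the same
functor. -/
theorem IsTracedCompletion.exists_iso {B B' : ℕ → ℕ → Type u} {T : TracedPropStr B}
    {T' : TracedPropStr B'} {κ : PropFunctor P T.toPropStr} {κ' : PropFunctor P T'.toPropStr}
    (h : IsTracedCompletion.{u, u, u} P T κ) (h' : IsTracedCompletion.{u, u, u} P T' κ') :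
    ∃ e : TracedPropIso T T', ∀ (a b : ℕ) (f : A a b), e.hom.map (κ.map f) = κ'.map f := by
  obtain ⟨F, hF, -⟩ := h B' T' κ'
  obtain ⟨G, hG, -⟩ := h' B T κ
  have hFG : F.trans G = TracedPropFunctor.refl T := (h B T κ).unique
    (fun a b f => by
      change G.map (F.map (κ.map f)) = _
      rw [hF, hG]) (fun a b f => rfl)
  have hGF : G.trans F = TracedPropFunctor.refl T' := (h' B' T' κ').unique
    (fun a b f => by
      change F.map (G.map (κ'.map f)) = _
      rw [hG, hF]) (fun a b f => rfl)
  refine ⟨⟨F, G, fun {a b} f => ?_, fun {a b} f => ?_⟩, hF⟩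
  · exact congrArg (fun K : TracedPropFunctor T T => K.map f) hFG
  · exact congrArg (fun K : TracedPropFunctor T' T' => K.map f) hGF

end Universal

theorem mainTheorem4 {A : ℕ → ℕ → Type u} (P : PropStr A) :
    ∃ (Q : TracedPropStr (TraceHom P)) (ι : PropFunctor P Q.toPropStr),
      -- empty morphism, identity wire, symmetry
      Q.empty = ofProp P P.empty ∧ Q.wire = ofProp P P.wire ∧ Q.sigma = ofProp P P.sigma ∧
      -- composition
      (∀ (p q r m n : ℕ) (M : A (p + m) (p + n)) (N : A (q + r) (q + m)),
        Q.comp (traceClass P p M) (traceClass P q N) =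
          traceClass P (q + m + p) (compRep P M N)) ∧
      -- tensor product
      (∀ (p q m n m' n' : ℕ) (M : A (p + m) (p + n)) (N : A (q + m') (q + n')),
        Q.tensor (traceClass P p M) (traceClass P q N) =
          traceClass P (p + q) (tensorRep P M N)) ∧
      -- trace
      (∀ (k m n : ℕ) (M : A (k + (1 + m)) (k + (1 + n))),
        Q.trace (traceClass P k M) =
          traceClass P (k + 1)
            (castHom (Nat.add_assoc k 1 m).symm (Nat.add_assoc k 1 n).symm M)) ∧
      -- the functor from `P`
      (∀ (a b : ℕ) (f : A a b), ι.map f = ofProp P f) ∧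
      -- `Q` is a traced completion of `P`
      IsTracedCompletion.{u, u, w} P Q ι ∧
      -- every traced completion of `P` is isomorphic to `Q`, compatibly with the functors from `P`
      (∀ (B : ℕ → ℕ → Type u) (T : TracedPropStr B) (κ : PropFunctor P T.toPropStr),
        IsTracedCompletion.{u, u, u} P T κ →
          ∃ e : TracedPropIso T Q, ∀ (a b : ℕ) (f : A a b), e.hom.map (κ.map f) = ι.map f) := by
  refine ⟨P.traceProp, P.toTraceProp, rfl, rfl, rfl, fun _ _ _ _ _ _ _ => rfl,
    fun _ _ _ _ _ _ _ _ => rfl, fun _ _ _ _ => rfl, fun _ _ _ => rfl,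
    isTracedCompletion_traceProp P, fun B T κ hκ => ?_⟩
  exact hκ.exists_iso (isTracedCompletion_traceProp P)
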